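/- **Setting.** All logarithms are natural. Let $\mathbb{X}$ be a finite alphabet. A source $\mathbf{X}=(P_{X^n})_n$ is a sequence of PMFs $P_{X^n}$ on $\mathbb{X}^n$ (no consistency required). For PMFs on a finite set, $H$ is the Shannon entropy and $D(\cdot\|\cdot)$ the Kullback–Leibler divergence ($+\infty$ unless absolutely continuous). For $R,\rho>0$ put $$E_n^s(R,\rho)=\min_{L_n}\frac1n\ln \mathbb{E}\big[\exp\{\rho\min\{L_n(X^n)\ln 2,\;nR\}\}\big],$$ the minimum being over all $L_n:\mathbb{X}^n\to\mathbb{N}$ with $\sum_{x^n}2^{-L_n(x^n)}\le 1$, and let $E_u^s=\limsup_n E_n^s$, $E_l^s=\liminf_n E_n^s$. For sources $\mathbf{Y},\mathbf{X}$ and $\theta\ge 0$ let $$D_u(\mathbf{Y}\|\mathbf{X})=\limsup_n\tfrac1n D(P_{Y^n}\|P_{X^n}),$$ let $E_u(\mathbf{Y},\mathbf{X},\theta)$ and $E_l(\mathbf{Y},\mathbf{X},\theta)$ be the $\limsup$ and $\liminf$ of $\frac1n\{\theta H(P_{Y^n})-D(P_{Y^n}\|P_{X^n})\}$, and let $$\overline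 H(\mathbf{Y})=\inf\{t:\lim_n\Pr\{\tfrac1n\ln\tfrac1{P_{Y^n}(Y^n)}>t\}=0\},\qquad \underline H(\mathbf{Y})=\sup\{t:\lim_n\Pr\{\tfrac1n\ln\tfrac1{P_{Y^n}(Y^n)}<t\}=0\}.$$ Define the general lower and upper bounds (with $\inf\emptyset=+\infty$, $\sup\emptyset=-\infty$) $$B_l(R,\rho)=\max\Big\{\rho R-\inf_{\mathbf{Y}:\underline H(\mathbf{Y})>R}D_u(\mathbf{Y}\|\mathbf{X}),\ \sup_{\mathbf{Y}:\overline H(\mathbf{Y})\le R}E_l(\mathbf{Y},\mathbf{X},\rho)\Big\},$$ $$B_u(R,\rho)=\inf_{0\le\theta\le\rho}\Big\{(\rho-\theta)R+\sup_{\mathbf{Y}}E_u(\mathbf{Y},\mathbf{X},\theta)\Big\}.$$ For a finite set $S$ and a transition matrix $\pi$ on $S$ put $$E_\pi(R,\rho)=\sup_{Q}\big\{\rho\min\{H(\eta\mid q),R\}-D(\eta\|\pi\mid q)\big\},$$ the supremum being over all PMFs $Q$ on $S^2$ with equal marginals. Here $q$ is the common marginal, $Q=q\times\eta$ (with $\eta(\cdot\mid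 s)$ uniform if $q(s)=0$), $H(\eta\mid q)=\sum_s q(s)H(\eta(\cdot\mid s))$ and $D(\eta\|\pi\mid q)=\sum_s q(s)D(\eta(\cdot\mid s)\|\pi(\cdot\mid s))$, with $0\cdot\infty=0$. **Statement.** Let $R>0$ and $\rho>0$. 1. (Markov source.) Let $\mathbf{X}$ be an irreducible stationary Markov source on $\mathbb{X}$ with transition matrix $\pi$. Then $$B_l(R,\rho)=E_l^s(R,\rho)=E_u^s(R,\rho)=B_u(R,\rho)=E_\pi(R,\rho).$$ 2. (Unifilar source.) Let $(Z_i)_{i\ge1}$ be an irreducible stationary Markov chain on a finite state space $S$ with transition matrix $\pi$, and let $f:S\to\mathbb{X}$ be such that, for each state $s$, the states reachable from $s$ in one step carry distinct letters (if $\pi(t\mid s)>0$, $\pi(u\mid s)>0$ and $f(t)=f(u)$, then $t=u$). Let $\mathbf{X}$ be the source of laws of $X^n=(f(Z_1),\dots,f(Z_n))$. Then $$B_l(R,\rho)=E_l^s(R,\rho)=E_u^s(R,\rho)=B_u(R,\rho)=E_\pi(R,\rho),$$ with $E_\pi$ computed for the state chain on $S$. -/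

import Mathlib

namespace ShannonCipher

open Filter Topology

/-! Sources over a finite alphabet.  A PMF on a finite set `α` is an element of `stdSimplex ℝ α`.
All logarithms are natural, so entropies, divergences and rates are in nats. -/

/-- A family of functions on the sets of `n`-letter messages (a source if each one is a PMF). -/
abbrev MessageLaw (X : Type*) := ∀ n : ℕ, (Fin n → X) → ℝ

/-- A source: a sequence of PMFs, the `n`-th one on `X ^ n`. No consistency is required. -/
def IsSource {X : Type*} [Fintype X] (P : MessageLaw X) : Prop :=
  ∀ n, P n ∈ stdSimplex ℝ (Fin n → X)

/-- Shannon entropy in nats. -/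
noncomputable def entropy {α : Type*} [Fintype α] (p : α → ℝ) : ℝ :=
  ∑ a, Real.negMulLog (p a)

open Classical in
/-- Kullback-Leibler divergence `D(p ‖ q)` in nats; it is `∞` unless `p ≪ q`. -/
noncomputable def divergence {α : Type*} [Fintype α] (p q : α → ℝ) : EReal :=
  if ∀ a, q a = 0 → p a = 0 then ((∑ a, p a * Real.log (p a / q a) : ℝ) : EReal) else ⊤

/-! The compression problem with saturated exponential cost. -/

/-- Kraft's inequality for a binary code alphabet. -/
def Kraft {α : Type*} [Fintype α] (L : α → ℕ) : Prop :=
  ∑ a, (2 : ℝ)⁻¹ ^ L a ≤ 1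

/-- Normalized exponent of the expected cost of the length function `L` on `X ^ n`. -/
noncomputable def costExponent {X : Type*} [Fintype X] (P : MessageLaw X) (R ρ : ℝ) (n : ℕ)
    (L : (Fin n → X) → ℕ) : ℝ :=
  1 / (n : ℝ) *
    Real.log (∑ x, P n x * Real.exp (ρ * min ((L x : ℝ) * Real.log 2) ((n : ℝ) * R)))

/-- `E_n^s(R, ρ)`: the smallest cost exponent of a length function on `X ^ n`. -/
noncomputable def compressionExponent {X : Type*} [Fintype X] (P : MessageLaw X) (R ρ : ℝ)
    (n : ℕ) : EReal :=
  ⨅ L : {L : (Fin n → X) → ℕ // Kraft L}, ((costExponent P R ρ n L.1 : ℝ) : EReal)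

/-- `E_u^s(R, ρ)`. -/
noncomputable def upperExponent {X : Type*} [Fintype X] (P : MessageLaw X) (R ρ : ℝ) : EReal :=
  limsup (fun n => compressionExponent P R ρ n) atTop

/-- `E_l^s(R, ρ)`. -/
noncomputable def lowerExponent {X : Type*} [Fintype X] (P : MessageLaw X) (R ρ : ℝ) : EReal :=
  liminf (fun n => compressionExponent P R ρ n) atTop

/-! Information-spectrum quantities and the two general bounds. -/

/-- `D_u(Y ‖ X)`, the upper divergence rate of the source `Q` from the source `P`. -/
noncomputable def upperDivergence {X : Type*} [Fintype X] (Q P : MessageLaw X) : EReal :=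
  limsup (fun n : ℕ => ((1 / (n : ℝ) : ℝ) : EReal) * divergence (Q n) (P n)) atTop

/-- `(1 / n) (ρ H(Y^n) - D(Y^n ‖ X^n))`. -/
noncomputable def tradeoff {X : Type*} [Fintype X] (Q P : MessageLaw X) (ρ : ℝ) (n : ℕ) : EReal :=
  ((1 / (n : ℝ) : ℝ) : EReal) * (((ρ * entropy (Q n) : ℝ) : EReal) - divergence (Q n) (P n))

/-- `E_u(Y, X, ρ)`. -/
noncomputable def upperTradeoff {X : Type*} [Fintype X] (Q P : MessageLaw X) (ρ : ℝ) : EReal :=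
  limsup (fun n => tradeoff Q P ρ n) atTop

/-- `E_l(Y, X, ρ)`. -/
noncomputable def lowerTradeoff {X : Type*} [Fintype X] (Q P : MessageLaw X) (ρ : ℝ) : EReal :=
  liminf (fun n => tradeoff Q P ρ n) atTop

/-- Probability, under `Q n`, that `(1 / n) ln (1 / Q n)` exceeds `t`. -/
noncomputable def probAbove {X : Type*} [Fintype X] (Q : MessageLaw X) (t : ℝ) (n : ℕ) : ℝ :=
  ∑ x with t < 1 / (n : ℝ) * Real.log (1 / Q n x), Q n x

/-- Probability, under `Q n`, that `(1 / n) ln (1 / Q n)` is below `t`. -/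
noncomputable def probBelow {X : Type*} [Fintype X] (Q : MessageLaw X) (t : ℝ) (n : ℕ) : ℝ :=
  ∑ x with 1 / (n : ℝ) * Real.log (1 / Q n x) < t, Q n x

/-- Spectral sup-entropy-rate. -/
noncomputable def supEntropyRate {X : Type*} [Fintype X] (Q : MessageLaw X) : EReal :=
  ⨅ (t : ℝ) (_ : Tendsto (probAbove Q t) atTop (𝓝 0)), (t : EReal)

/-- Spectral inf-entropy-rate. -/
noncomputable def infEntropyRate {X : Type*} [Fintype X] (Q : MessageLaw X) : EReal :=
  ⨆ (t : ℝ) (_ : Tendsto (probBelow Q t) atTop (𝓝 0)), (t : EReal)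

/-- The general lower bound on `E_l^s(R, ρ)`:
`max {ρ R - inf {D_u(Y ‖ X) | inf-entropy-rate of Y > R},
      sup {E_l(Y, X, ρ) | sup-entropy-rate of Y ≤ R}}`. -/
noncomputable def generalLowerBound {X : Type*} [Fintype X] (P : MessageLaw X) (R ρ : ℝ) : EReal :=
  max
    (((ρ * R : ℝ) : EReal) -
      ⨅ (Q : MessageLaw X) (_ : IsSource Q) (_ : (R : EReal) < infEntropyRate Q),
        upperDivergence Q P)
    (⨆ (Q : MessageLaw X) (_ : IsSource Q) (_ : supEntropyRate Q ≤ (R : EReal)),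
      lowerTradeoff Q P ρ)

/-- The general upper bound on `E_u^s(R, ρ)`:
`inf over 0 ≤ θ ≤ ρ of {(ρ - θ) R + sup over all sources Y of E_u(Y, X, θ)}`. -/
noncomputable def generalUpperBound {X : Type*} [Fintype X] (P : MessageLaw X) (R ρ : ℝ) : EReal :=
  ⨅ θ ∈ Set.Icc (0 : ℝ) ρ,
    ((((ρ - θ) * R : ℝ) : EReal) +
      ⨆ (Q : MessageLaw X) (_ : IsSource Q), upperTradeoff Q P θ)

/-! Markov and unifilar sources. -/

/-- `π` is an irreducible transition probability matrix with stationary distribution `p`. -/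
structure IsIrreducibleStationary {S : Type*} [Fintype S] (π : Matrix S S ℝ) (p : S → ℝ) :
    Prop where
  stochastic : ∀ s, π s ∈ stdSimplex ℝ S
  irreducible : π.IsIrreducible
  initial : p ∈ stdSimplex ℝ S
  stationary : Matrix.vecMul p π = p

/-- Law of the first `n` letters of the Markov chain with initial distribution `p` and transition
matrix `π`: `p(x_1) π(x_2 | x_1) ⋯ π(x_n | x_{n-1})`. -/
def markovLaw {S : Type*} (p : S → ℝ) (π : Matrix S S ℝ) : MessageLaw S
  | 0, _ => 1
  | n + 1, x => p (x 0) * ∏ i : Fin n, π (x i.castSucc) (x i.succ)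

/-- The letter map `f` on states is unifilar for `π`: from each state, the states that can be
reached in one step carry distinct letters. -/
def IsUnifilar {S X : Type*} (π : Matrix S S ℝ) (f : S → X) : Prop :=
  ∀ s t u, 0 < π s t → 0 < π s u → f t = f u → t = u

open Classical in
/-- Law of the first `n` letters `f(s_1), …, f(s_n)` put out by the state chain. -/
noncomputable def outputLaw {S X : Type*} [Fintype S] (p : S → ℝ) (π : Matrix S S ℝ) (f : S → X) :
    MessageLaw X :=
  fun n x => ∑ s : Fin n → S with f ∘ s = x, markovLaw p π n s

/-! The single-letter formula. -/

/-- Stationary PMFs on `S × S`: the two marginals agree. -/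
def stationaryPairs (S : Type*) [Fintype S] : Set (S × S → ℝ) :=
  {Q | Q ∈ stdSimplex ℝ (S × S) ∧ ∀ s, ∑ t, Q (t, s) = ∑ t, Q (s, t)}

/-- The marginal `q` of `Q`. -/
def marginal {S : Type*} [Fintype S] (Q : S × S → ℝ) (s : S) : ℝ :=
  ∑ t, Q (s, t)

open Classical in
/-- The conditional distribution `η(· | s)` of `Q = q × η`, uniform where `q` vanishes. -/
noncomputable def condDist {S : Type*} [Fintype S] (Q : S × S → ℝ) (s t : S) : ℝ :=
  if marginal Q s ≠ 0 then Q (s, t) / marginal Q s else 1 / (Fintype.card S : ℝ)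

/-- `H(η | q)`. -/
noncomputable def condEntropy {S : Type*} [Fintype S] (Q : S × S → ℝ) : ℝ :=
  ∑ s, marginal Q s * entropy (condDist Q s)

/-- `D(η ‖ π | q)`, with the convention `0 · ∞ = 0`. -/
noncomputable def condDivergence {S : Type*} [Fintype S] (Q : S × S → ℝ) (π : Matrix S S ℝ) :
    EReal :=
  ∑ s, (marginal Q s : EReal) * divergence (condDist Q s) (π s)

/-- `sup {ρ min {H(η | q), R} - D(η ‖ π | q)}` over all stationary PMFs `Q = q × η`. -/
noncomputable def markovExponent {S : Type*} [Fintype S] (π : Matrix S S ℝ) (R ρ : ℝ) : EReal :=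
  ⨆ Q ∈ stationaryPairs S,
    (((ρ * min (condEntropy Q) R : ℝ) : EReal) - condDivergence Q π)

end ShannonCipher

namespace ShannonCipher

open Filter Topology

/-! ### Entropy and divergence inequalities -/

section Information

variable {α : Type*} [Fintype α]

/-! The five quantities close up in a cycle `E_π ≤ B_l ≤ E_l^s ≤ E_u^s ≤ B_u ≤ E_π`, proved for
unifilar outputs; a Markov source is the case where the letter map is the identity. `B_l ≤ E_l^s`
and `E_u^s ≤ B_u` hold for every source. For the first, Donsker–Varadhan bounds the log-moment under
`P` below by `ρ E_Q[min{L ln 2, nR}] - D(Q‖P)` for any auxiliary law `Q`. Kraft's inequality forces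
the mean truncated length to be nearly `H(Q)` if the entropy spectrum of `Q` lies below `R`, and
nearly `nR` if it lies above. For the second, `ρ min{a, b} ≤ θ a + (ρ - θ) b`, and a Shannon code
for the law proportional to `P ^ (1 / (1 + θ))` has exponent `(1 + θ) ln ∑ P ^ (1 / (1 + θ))`, which
is also the maximum of `θ H - D` over all laws. `B_u ≤ E_π` is Perron–Frobenius plus minimax. The
tilted sum grows at most like `r ^ n`, where `r` is the Perron root of the entrywise power of `π`,
and `(1 + θ) ln r` is the value of `θ H(η|q) - D(η‖π|q)` at an explicit Gibbs pair
(`exists_gibbs_pair`). Sion's theorem (`exists_saddle`) exchanges the infimum over `θ` with the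
supremum over `Q`, and the infimum over `θ` produces `ρ min{H, R}`. `E_π ≤ B_l` inserts auxiliary
chains into `B_l`. A pair law charging every transition of `π` yields an irreducible chain; started
from a fixed state, its path is determined by the emitted word, so its information density is an
additive functional. Poisson's equation (`exists_poisson`) makes this functional a martingale up to
a bounded error, so the entropy spectrum concentrates at `H(η|q)` (`exists_pathSum_moments`). Other
pair laws are limits of mixtures with the stationary pair law. -/

lemma mul_log_sub_log_le {p w : ℝ} (hp : 0 ≤ p) (hw : 0 ≤ w) (h : w = 0 → p = 0) :
    p * (Real.log w - Real.log p) ≤ w - p := by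
  rcases hp.eq_or_lt with rfl | hp
  · simpa using hw
  have hw' : 0 < w := hw.lt_of_ne fun h0 => hp.ne' (h h0.symm)
  rw [← Real.log_div hw'.ne' hp.ne']
  calc p * Real.log (w / p) ≤ p * (w / p - 1) := by
        gcongr; exact Real.log_le_sub_one_of_pos (by positivity)
    _ = w - p := by field_simp

omit [Fintype α] in
lemma sum_mul_log_sub_log_le (s : Finset α) {p w : α → ℝ} (hp : ∀ a, 0 ≤ p a)
    (hw : ∀ a, 0 ≤ w a) (h : ∀ a, w a = 0 → p a = 0) :
    ∑ a ∈ s, p a * (Real.log (w a) - Real.log (p a)) ≤ ∑ a ∈ s, w a - ∑ a ∈ s, p a := by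
  rw [← Finset.sum_sub_distrib]
  exact Finset.sum_le_sum fun a _ => mul_log_sub_log_le (hp a) (hw a) (h a)

lemma entropy_eq (p : α → ℝ) : entropy p = -∑ a, p a * Real.log (p a) := by
  simp [entropy, Real.negMulLog]

/-- Gibbs' inequality for a subprobability `w`. -/
lemma sum_mul_log_le_neg_entropy {p w : α → ℝ} (hp : p ∈ stdSimplex ℝ α)
    (hw : ∀ a, 0 ≤ w a) (hw1 : ∑ a, w a ≤ 1) (h : ∀ a, w a = 0 → p a = 0) :
    ∑ a, p a * Real.log (w a) ≤ -entropy p := by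
  have := sum_mul_log_sub_log_le Finset.univ hp.1 hw h
  simp only [mul_sub, Finset.sum_sub_distrib, hp.2] at this
  rw [entropy_eq]
  linarith

lemma entropy_nonneg {p : α → ℝ} (hp : p ∈ stdSimplex ℝ α) : 0 ≤ entropy p :=
  Finset.sum_nonneg fun a _ => Real.negMulLog_nonneg (hp.1 a)
    (hp.2 ▸ Finset.single_le_sum (fun b _ => hp.1 b) (Finset.mem_univ a))

/-- Comparison with the uniform weights on `s`, whose total mass accounts for the `1`. It makes the
entropy carried by an atypical set small once its probability is small. -/
lemma sum_negMulLog_le [Nonempty α] (s : Finset α) {p : α → ℝ} (hp : ∀ a, 0 ≤ p a) :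
    ∑ a ∈ s, Real.negMulLog (p a) ≤ (∑ a ∈ s, p a) * Real.log (Fintype.card α) + 1 := by
  have hc : (0 : ℝ) < Fintype.card α := by exact_mod_cast Fintype.card_pos
  have := sum_mul_log_sub_log_le s hp (w := fun _ => (Fintype.card α : ℝ)⁻¹)
    (fun _ => by positivity) (fun a h => absurd h (by positivity))
  have h1 : ∑ _a ∈ s, (Fintype.card α : ℝ)⁻¹ ≤ 1 := by
    rw [Finset.sum_const, nsmul_eq_mul, ← div_eq_mul_inv, div_le_one hc]
    exact_mod_cast Finset.card_le_univ s
  have h2 : 0 ≤ ∑ a ∈ s, p a := Finset.sum_nonneg fun a _ => hp a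
  simp only [mul_sub, Finset.sum_sub_distrib, Real.log_inv, mul_neg, Finset.sum_neg_distrib,
    ← Finset.sum_mul] at this
  simp only [Real.negMulLog, neg_mul, Finset.sum_neg_distrib]
  linarith

lemma mul_log_div {p q : ℝ} (h : q = 0 → p = 0) :
    p * Real.log (p / q) = p * (Real.log p - Real.log q) := by
  rcases eq_or_ne p 0 with rfl | hp
  · simp
  · rw [Real.log_div hp fun h0 => hp (h h0)]

lemma divergence_of_ac {p q : α → ℝ} (h : ∀ a, q a = 0 → p a = 0) :
    divergence p q = ((∑ a, p a * (Real.log (p a) - Real.log (q a)) : ℝ) : EReal) := by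
  rw [divergence, if_pos h]
  exact congrArg _ (Finset.sum_congr rfl fun a _ => mul_log_div (h a))

lemma divergence_of_not_ac {p q : α → ℝ} (h : ¬ ∀ a, q a = 0 → p a = 0) :
    divergence p q = ⊤ := by
  rw [divergence, if_neg h]

/-- The easy half of the Donsker-Varadhan formula. -/
lemma sum_mul_sub_le_log_sum_exp {p q : α → ℝ} (hp : p ∈ stdSimplex ℝ α)
    (hq : ∀ a, 0 ≤ q a) (h : ∀ a, q a = 0 → p a = 0) (g : α → ℝ) :
    ∑ a, p a * g a - ∑ a, p a * (Real.log (p a) - Real.log (q a)) ≤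
      Real.log (∑ a, q a * Real.exp (g a)) := by
  set Z := ∑ a, q a * Real.exp (g a)
  obtain ⟨a₀, ha₀⟩ : ∃ a, 0 < p a := by
    by_contra! hc
    have h0 : ∑ a, p a = 0 := Finset.sum_eq_zero fun a _ => le_antisymm (hc a) (hp.1 a)
    exact zero_ne_one (h0.symm.trans hp.2)
  have hq0 : 0 < q a₀ := (hq a₀).lt_of_ne fun h0 => ha₀.ne' (h a₀ h0.symm)
  have hZ : 0 < Z := Finset.sum_pos' (fun a _ => mul_nonneg (hq a) (Real.exp_pos _).le)
    ⟨a₀, Finset.mem_univ _, by positivity⟩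
  -- Gibbs' inequality against the exponential tilt of `q` by `g`.
  have hg := sum_mul_log_le_neg_entropy hp (w := fun a => q a * Real.exp (g a) / Z)
    (fun a => div_nonneg (mul_nonneg (hq a) (Real.exp_pos _).le) hZ.le)
    (by rw [← Finset.sum_div, div_self hZ.ne']) (fun a ha => h a (by
      simpa [hZ.ne', (Real.exp_pos _).ne'] using ha))
  have key : ∀ a, p a * Real.log (q a * Real.exp (g a) / Z) =
      p a * Real.log (q a) + p a * g a - p a * Real.log Z := by
    intro a
    rcases eq_or_ne (p a) 0 with h0 | h0
    · simp [h0]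
    · have hqa : q a ≠ 0 := fun h1 => h0 (h a h1)
      rw [Real.log_div (mul_ne_zero hqa (Real.exp_pos _).ne') hZ.ne',
        Real.log_mul hqa (Real.exp_pos _).ne', Real.log_exp]
      ring
  simp only [key, Finset.sum_add_distrib, Finset.sum_sub_distrib, ← Finset.sum_mul, hp.2,
    entropy_eq] at hg
  simp only [mul_sub, Finset.sum_sub_distrib]
  linarith

end Information

/-! ### Limits in the extended reals -/

lemma liminf_le_liminf_of_forall_pos {u v : ℕ → EReal}
    (h : ∀ ε : ℝ, 0 < ε → ∀ᶠ n in atTop, u n ≤ v n + (ε : EReal)) :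
    liminf u atTop ≤ liminf v atTop := by
  refine le_of_forall_lt fun c hc => ?_
  obtain ⟨d, hcd, hd⟩ := EReal.lt_iff_exists_real_btwn.1 hc
  obtain ⟨e, hde, he⟩ := EReal.lt_iff_exists_real_btwn.1 hd
  have hde' : d < e := by exact_mod_cast hde
  refine hcd.trans_le (le_liminf_of_le (by isBoundedDefault) ?_)
  filter_upwards [h (e - d) (by linarith), eventually_lt_of_lt_liminf he] with n h1 h2
  have h3 : (e : EReal) ≤ v n + ((e - d : ℝ) : EReal) := h2.le.trans h1
  have h4 := EReal.sub_le_of_le_add h3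
  rwa [← EReal.coe_sub, sub_sub_cancel] at h4

lemma limsup_le_limsup_of_forall_pos {u v : ℕ → EReal}
    (h : ∀ ε : ℝ, 0 < ε → ∀ᶠ n in atTop, u n ≤ v n + (ε : EReal)) :
    limsup u atTop ≤ limsup v atTop := by
  refine le_of_forall_gt fun c hc => ?_
  obtain ⟨d, hd, hdc⟩ := EReal.lt_iff_exists_real_btwn.1 hc
  obtain ⟨e, he, hed⟩ := EReal.lt_iff_exists_real_btwn.1 hd
  have hde' : e < d := by exact_mod_cast hed
  refine lt_of_le_of_lt (limsup_le_of_le (by isBoundedDefault) ?_) hdc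
  filter_upwards [h (d - e) (by linarith), eventually_lt_of_limsup_lt he] with n h1 h2
  calc u n ≤ v n + ((d - e : ℝ) : EReal) := h1
    _ ≤ (e : EReal) + ((d - e : ℝ) : EReal) := by gcongr
    _ = (d : EReal) := by rw [← EReal.coe_add]; congr 1; ring

lemma tendsto_one_div_nat_mul (c : ℝ) : Tendsto (fun n : ℕ => 1 / (n : ℝ) * c) atTop (𝓝 0) := by
  simpa using tendsto_one_div_atTop_nhds_zero_nat.mul_const c

lemma eventually_one_div_nat_mul_le (c : ℝ) {ε : ℝ} (hε : 0 < ε) :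
    ∀ᶠ n : ℕ in atTop, 1 / (n : ℝ) * c ≤ ε :=
  ((tendsto_one_div_nat_mul c).eventually_lt_const hε).mono fun _ => le_of_lt

lemma coe_mul_sub_divergence {α : Type*} [Fintype α] {p q : α → ℝ}
    (h : ∀ a, q a = 0 → p a = 0) (c d : ℝ) :
    (c : EReal) * ((d : EReal) - divergence p q) =
      ((c * (d - ∑ a, p a * (Real.log (p a) - Real.log (q a))) : ℝ) : EReal) := by
  rw [divergence_of_ac h, ← EReal.coe_sub, ← EReal.coe_mul]

/-- Strict positivity of `c` matters: at `n = 0` the factor `1 / n` is `0` and kills the infinite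
divergence, so the uses restrict to positive `n`. -/
lemma coe_mul_sub_divergence_of_not {α : Type*} [Fintype α] {p q : α → ℝ}
    (h : ¬ ∀ a, q a = 0 → p a = 0) {c : ℝ} (hc : 0 < c) (d : ℝ) :
    (c : EReal) * ((d : EReal) - divergence p q) = ⊥ := by
  rw [divergence_of_not_ac h, EReal.sub_top, EReal.coe_mul_bot_of_pos hc]

/-! ### The general lower bound -/

section Converse

variable {X : Type*} [Fintype X]

lemma exp_neg_natCast_mul_log_two (k : ℕ) :
    Real.exp (-((k : ℝ) * Real.log 2)) = (2 : ℝ)⁻¹ ^ k := by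
  rw [Real.exp_neg, Real.exp_nat_mul, Real.exp_log two_pos, inv_pow]

/-- Donsker–Varadhan with the cost as test function: the code then enters only through its mean
truncated length under `Q`. -/
lemma costExponent_ge {P Q : MessageLaw X} (hP : IsSource P) (hQ : IsSource Q) (R ρ : ℝ)
    {n : ℕ} (h : ∀ x, P n x = 0 → Q n x = 0) (L : (Fin n → X) → ℕ) :
    1 / (n : ℝ) * (ρ * ∑ x, Q n x * min ((L x : ℝ) * Real.log 2) ((n : ℝ) * R)
      - ∑ x, Q n x * (Real.log (Q n x) - Real.log (P n x))) ≤ costExponent P R ρ n L := by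
  rw [costExponent]
  gcongr
  have := sum_mul_sub_le_log_sum_exp (hQ n) (hP n).1 h
    (fun x => ρ * min ((L x : ℝ) * Real.log 2) ((n : ℝ) * R))
  rw [Finset.mul_sum]
  refine le_trans (le_of_eq ?_) this
  congr 1
  exact Finset.sum_congr rfl fun x _ => by ring

/-- A bound on the truncated lengths gives a bound on the compression exponent. -/
lemma compressionExponent_ge {P Q : MessageLaw X} (hP : IsSource P) (hQ : IsSource Q) {R ρ : ℝ}
    (hρ : 0 ≤ ρ) {n : ℕ} (hn : 0 < n) {A : ℝ}
    (hA : ∀ L : (Fin n → X) → ℕ, Kraft L →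
      A ≤ ∑ x, Q n x * min ((L x : ℝ) * Real.log 2) ((n : ℝ) * R)) :
    ((1 / (n : ℝ) : ℝ) : EReal) * (((ρ * A : ℝ) : EReal) - divergence (Q n) (P n)) ≤
      compressionExponent P R ρ n := by
  have hn' : (0 : ℝ) < 1 / n := by positivity
  refine le_iInf fun ⟨L, hL⟩ => ?_
  by_cases h : ∀ x, P n x = 0 → Q n x = 0
  · rw [coe_mul_sub_divergence h]
    refine EReal.coe_le_coe_iff.2 (le_trans ?_ (costExponent_ge hP hQ R ρ h L))
    gcongr
    exact hA L hL
  · rw [coe_mul_sub_divergence_of_not h hn']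
    exact bot_le

lemma min_natCast_mul_log_two_nonneg {R : ℝ} (hR : 0 ≤ R) (n k : ℕ) :
    0 ≤ min ((k : ℝ) * Real.log 2) ((n : ℝ) * R) :=
  le_min (mul_nonneg k.cast_nonneg (Real.log_nonneg one_le_two)) (mul_nonneg n.cast_nonneg hR)

lemma natCast_lt_of_one_div_mul_lt {n : ℕ} (hn : 0 < n) {a t : ℝ} :
    t < 1 / (n : ℝ) * a ↔ n * t < a := by
  rw [one_div_mul_eq_div, lt_div_iff₀ (by exact_mod_cast hn), mul_comm]

lemma one_div_mul_lt_iff {n : ℕ} (hn : 0 < n) {a t : ℝ} :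
    1 / (n : ℝ) * a < t ↔ a < n * t := by
  rw [one_div_mul_eq_div, div_lt_iff₀ (by exact_mod_cast hn), mul_comm]

/-- Off the atypical set `B`, the weight `2⁻ᴸ + Q` dominates `exp(-min - nδ)` in both branches of
the minimum, so Gibbs' inequality costs only the Kraft sum, at most `1`. On `B` the lengths are
dropped and the entropy is bounded crudely, which costs the other `1`. -/
lemma sum_truncated_ge_entropy {Q : MessageLaw X} (hQ : IsSource Q) {R δ : ℝ} (hR : 0 ≤ R)
    (hδ : 0 ≤ δ) {n : ℕ} (hn : 0 < n) [Nonempty X] {L : (Fin n → X) → ℕ} (hL : Kraft L) :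
    entropy (Q n) - (n * δ + 2 + probAbove Q (R + δ) n * (n * Real.log (Fintype.card X))) ≤
      ∑ x, Q n x * min ((L x : ℝ) * Real.log 2) ((n : ℝ) * R) := by
  classical
  have hq := (hQ n).1
  set m : (Fin n → X) → ℝ := fun x => min ((L x : ℝ) * Real.log 2) ((n : ℝ) * R)
  set B := Finset.univ.filter fun x => R + δ < 1 / (n : ℝ) * Real.log (1 / Q n x) with hB
  set T := Finset.univ.filter fun x => ¬ (R + δ < 1 / (n : ℝ) * Real.log (1 / Q n x)) with hT
  have hsplit : ∀ f : (Fin n → X) → ℝ, ∑ x, f x = ∑ x ∈ B, f x + ∑ x ∈ T, f x := fun f =>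
    (Finset.sum_filter_add_sum_filter_not _ _ _).symm
  have hB1 := sum_negMulLog_le B hq
  rw [Fintype.card_fun, Fintype.card_fin, Nat.cast_pow, Real.log_pow] at hB1
  have hB2 : 0 ≤ ∑ x ∈ B, Q n x * m x :=
    Finset.sum_nonneg fun x _ => mul_nonneg (hq x) (min_natCast_mul_log_two_nonneg hR n _)
  have hT1 : ∀ x ∈ T, Real.negMulLog (Q n x) - Q n x * m x ≤
      Q n x * (n * δ) + ((2 : ℝ)⁻¹ ^ L x + Q n x - Q n x) := by
    intro x hx
    have hxT : ¬ (R + δ < 1 / (n : ℝ) * Real.log (1 / Q n x)) := (Finset.mem_filter.1 hx).2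
    rw [natCast_lt_of_one_div_mul_lt hn, not_lt, one_div, Real.log_inv] at hxT
    rcases (hq x).eq_or_lt with h0 | h0
    · rw [← h0]; simp
    have hw : (0 : ℝ) < (2 : ℝ)⁻¹ ^ L x := by positivity
    have h1 := mul_log_sub_log_le (hq x) (w := (2 : ℝ)⁻¹ ^ L x + Q n x) (by positivity)
      (fun h => absurd h (by positivity))
    have h2 : -m x ≤ n * δ + Real.log ((2 : ℝ)⁻¹ ^ L x + Q n x) := by
      have h3 : Real.log (Q n x) ≤ Real.log ((2 : ℝ)⁻¹ ^ L x + Q n x) :=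
        Real.log_le_log h0 (by linarith)
      have h4 : -((L x : ℝ) * Real.log 2) ≤ Real.log ((2 : ℝ)⁻¹ ^ L x + Q n x) := by
        rw [← Real.log_exp (-((L x : ℝ) * Real.log 2)), exp_neg_natCast_mul_log_two]
        exact Real.log_le_log hw (by linarith)
      have h5 : 0 ≤ n * δ := by positivity
      rcases min_choice ((L x : ℝ) * Real.log 2) ((n : ℝ) * R) with h6 | h6
      · simp only [m, h6]; linarith
      · simp only [m, h6]; linarith
    have h7 := mul_le_mul_of_nonneg_left h2 (hq x)
    simp only [Real.negMulLog]
    nlinarith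
  have hT2 := Finset.sum_le_sum hT1
  simp only [Finset.sum_sub_distrib, Finset.sum_add_distrib, ← Finset.sum_mul] at hT2
  have hT3 : ∑ x ∈ T, Q n x ≤ 1 := (hQ n).2 ▸
    Finset.sum_le_sum_of_subset_of_nonneg (Finset.subset_univ _) fun x _ _ => hq x
  have hT4 : ∑ x ∈ T, (2 : ℝ)⁻¹ ^ L x ≤ 1 := le_trans
    (Finset.sum_le_sum_of_subset_of_nonneg (Finset.subset_univ _) fun x _ _ => by positivity) hL
  have hT5 : (∑ x ∈ T, Q n x) * (n * δ) ≤ n * δ := mul_le_of_le_one_left (by positivity) hT3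
  have hpB : probAbove Q (R + δ) n = ∑ x ∈ B, Q n x := rfl
  rw [entropy, hsplit, hsplit (fun x => Q n x * m x), hpB]
  linarith

lemma tendsto_probAbove {Q : MessageLaw X} (hQ : IsSource Q) {t : ℝ}
    (h : supEntropyRate Q < (t : EReal)) : Tendsto (probAbove Q t) atTop (𝓝 0) := by
  simp only [supEntropyRate, iInf_lt_iff] at h
  obtain ⟨s, hs, hst⟩ := h
  have hst' : s < t := by exact_mod_cast hst
  refine squeeze_zero (fun n => Finset.sum_nonneg fun x _ => (hQ n).1 x) (fun n => ?_) hs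
  exact Finset.sum_le_sum_of_subset_of_nonneg
    (Finset.monotone_filter_right _ fun x _ hx => hst'.trans hx) fun x _ _ => (hQ n).1 x

lemma lowerTradeoff_le_lowerExponent [Nonempty X] {P Q : MessageLaw X} (hP : IsSource P)
    (hQ : IsSource Q) {R ρ : ℝ} (hR : 0 ≤ R) (hρ : 0 ≤ ρ) (h : supEntropyRate Q ≤ (R : EReal)) :
    lowerTradeoff Q P ρ ≤ lowerExponent P R ρ := by
  refine liminf_le_liminf_of_forall_pos fun ε hε => ?_
  -- A spectrum bounded by `R` has vanishing tails only strictly above `R`; the margin `δ` is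
  -- charged to half of `ε`.
  obtain ⟨δ, hδ, hδε⟩ : ∃ δ > 0, ρ * δ ≤ ε / 2 := by
    refine ⟨ε / (2 * (ρ + 1)), by positivity, ?_⟩
    rw [← mul_div_assoc, div_le_div_iff₀ (by positivity) two_pos]
    nlinarith
  have hp := tendsto_probAbove hQ (t := R + δ) (h.trans_lt (by exact_mod_cast lt_add_of_pos_right R hδ))
  have hlim : Tendsto (fun n : ℕ => ρ * (1 / (n : ℝ) * 2 +
      probAbove Q (R + δ) n * Real.log (Fintype.card X))) atTop (𝓝 0) := by
    simpa using ((tendsto_one_div_nat_mul 2).add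
      (hp.mul_const (Real.log (Fintype.card X)))).const_mul ρ
  filter_upwards [hlim.eventually_lt_const (half_pos hε), eventually_gt_atTop 0] with n h1 hn
  have hn' : (0 : ℝ) < n := by exact_mod_cast hn
  have h2 := compressionExponent_ge hP hQ hρ hn fun L hL =>
    sum_truncated_ge_entropy hQ hR hδ.le hn hL
  refine le_trans ?_ (add_le_add_left h2 _)
  rw [tradeoff]
  by_cases hac : ∀ x, P n x = 0 → Q n x = 0
  · rw [coe_mul_sub_divergence hac, coe_mul_sub_divergence hac, ← EReal.coe_add,
      EReal.coe_le_coe_iff]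
    have h3 : 1 / (n : ℝ) * (ρ * (n * δ + 2 +
        probAbove Q (R + δ) n * (n * Real.log (Fintype.card X)))) = ρ * δ +
        ρ * (1 / (n : ℝ) * 2 + probAbove Q (R + δ) n * Real.log (Fintype.card X)) := by
      field_simp
      ring
    have h4 : 1 / (n : ℝ) * (ρ * (n * δ + 2 +
        probAbove Q (R + δ) n * (n * Real.log (Fintype.card X)))) ≤ ε := by rw [h3]; linarith
    rw [mul_sub ρ, mul_sub, mul_sub, mul_sub]
    linarith
  · rw [coe_mul_sub_divergence_of_not hac (by positivity)]
    exact bot_le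

/-- A word outside `B` has `Q ≤ exp(-nt)`; if it is coded below the truncation level then `2⁻ᴸ ≥
exp(-nR)`, so `Q ≤ 2⁻ᴸ exp(-n(t - R))`. By Kraft such words have total mass at most `exp(-n(t -
R))`, and all other words outside `B` pay the full `nR`. -/
lemma sum_truncated_ge_of_probBelow {Q : MessageLaw X} (hQ : IsSource Q) {R t : ℝ} (hR : 0 ≤ R)
    {n : ℕ} (hn : 0 < n) {L : (Fin n → X) → ℕ} (hL : Kraft L) :
    n * R * (1 - probBelow Q t n - Real.exp (-(n * (t - R)))) ≤
      ∑ x, Q n x * min ((L x : ℝ) * Real.log 2) ((n : ℝ) * R) := by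
  classical
  have hq := (hQ n).1
  set B := Finset.univ.filter fun x => 1 / (n : ℝ) * Real.log (1 / Q n x) < t
  have hpB : probBelow Q t n = ∑ x ∈ B, Q n x := rfl
  have key : ∀ x, n * R * (Q n x - (if x ∈ B then Q n x else 0) -
      (2 : ℝ)⁻¹ ^ L x * Real.exp (-(n * (t - R)))) ≤
      Q n x * min ((L x : ℝ) * Real.log 2) ((n : ℝ) * R) := by
    intro x
    have hnR : 0 ≤ n * R := by positivity
    have hw : (0 : ℝ) < (2 : ℝ)⁻¹ ^ L x * Real.exp (-(n * (t - R))) := by positivity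
    have h0 : 0 ≤ Q n x * min ((L x : ℝ) * Real.log 2) ((n : ℝ) * R) :=
      mul_nonneg (hq x) (min_natCast_mul_log_two_nonneg hR n _)
    rcases le_total (n * R) ((L x : ℝ) * Real.log 2) with h1 | h1
    · rw [min_eq_right h1, mul_comm (Q n x)]
      gcongr
      have : 0 ≤ if x ∈ B then Q n x else 0 := by split_ifs; exacts [hq x, le_rfl]
      linarith
    · refine le_trans (mul_nonpos_of_nonneg_of_nonpos hnR ?_) h0
      by_cases hx : x ∈ B
      · rw [if_pos hx]; linarith
      rw [if_neg hx]
      have hx' : ¬ (1 / (n : ℝ) * Real.log (1 / Q n x) < t) := fun h =>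
        hx (Finset.mem_filter.2 ⟨Finset.mem_univ _, h⟩)
      rw [one_div_mul_lt_iff hn, not_lt, one_div, Real.log_inv] at hx'
      rcases (hq x).eq_or_lt with h2 | h2
      · rw [← h2]; linarith
      have h3 : Q n x ≤ (2 : ℝ)⁻¹ ^ L x * Real.exp (-(n * (t - R))) := by
        rw [← exp_neg_natCast_mul_log_two, ← Real.exp_add, ← Real.log_le_iff_le_exp h2]
        nlinarith
      linarith
  refine le_trans ?_ (Finset.sum_le_sum fun x _ => key x)
  rw [← Finset.mul_sum, Finset.sum_sub_distrib, Finset.sum_sub_distrib, (hQ n).2, hpB,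
    ← Finset.sum_mul]
  rw [Finset.sum_ite_mem, Finset.univ_inter]
  have hexp := Real.exp_pos (-(n * (t - R)))
  have : (∑ x, (2 : ℝ)⁻¹ ^ L x) * Real.exp (-(n * (t - R))) ≤ Real.exp (-(n * (t - R))) :=
    mul_le_of_le_one_left hexp.le hL
  gcongr

lemma exists_tendsto_probBelow {Q : MessageLaw X} {R : ℝ}
    (h : (R : EReal) < infEntropyRate Q) :
    ∃ t, R < t ∧ Tendsto (probBelow Q t) atTop (𝓝 0) := by
  simp only [infEntropyRate, lt_iSup_iff] at h
  obtain ⟨t, ht, hRt⟩ := h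
  exact ⟨t, by exact_mod_cast hRt, ht⟩

lemma sub_upperDivergence_le_lowerExponent {P Q : MessageLaw X} (hP : IsSource P)
    (hQ : IsSource Q) {R ρ : ℝ} (hR : 0 ≤ R) (hρ : 0 ≤ ρ) (h : (R : EReal) < infEntropyRate Q) :
    ((ρ * R : ℝ) : EReal) - upperDivergence Q P ≤ lowerExponent P R ρ := by
  obtain ⟨t, hRt, ht⟩ := exists_tendsto_probBelow h
  set d : ℕ → EReal := fun n => ((1 / (n : ℝ) : ℝ) : EReal) * divergence (Q n) (P n) with hd
  have h1 : ((ρ * R : ℝ) : EReal) - upperDivergence Q P ≤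
      liminf (fun n => ((ρ * R : ℝ) : EReal) + (-d) n) atTop := by
    rw [sub_eq_add_neg, upperDivergence, ← EReal.liminf_neg]
    refine le_trans (le_of_eq ?_) EReal.le_liminf_add
    rw [liminf_const]
  refine h1.trans (liminf_le_liminf_of_forall_pos fun ε hε => ?_)
  have hexp : Tendsto (fun n : ℕ => Real.exp (-(n * (t - R)))) atTop (𝓝 0) := by
    refine Real.tendsto_exp_neg_atTop_nhds_zero.comp ?_
    exact tendsto_natCast_atTop_atTop.atTop_mul_const (by linarith)
  have hlim : Tendsto (fun n : ℕ => ρ * R * (probBelow Q t n + Real.exp (-(n * (t - R)))))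
      atTop (𝓝 0) := by
    simpa using (ht.add hexp).const_mul (ρ * R)
  filter_upwards [hlim.eventually_lt_const hε, eventually_gt_atTop 0] with n h2 hn
  have hn' : (0 : ℝ) < n := by exact_mod_cast hn
  have h3 := compressionExponent_ge hP hQ hρ hn fun L hL =>
    sum_truncated_ge_of_probBelow (t := t) hQ hR hn hL
  refine le_trans ?_ (add_le_add_left h3 _)
  by_cases hac : ∀ x, P n x = 0 → Q n x = 0
  · rw [coe_mul_sub_divergence hac, Pi.neg_apply, hd]
    simp only
    rw [divergence_of_ac hac, ← EReal.coe_mul, ← EReal.coe_neg, ← EReal.coe_add,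
      ← EReal.coe_add, EReal.coe_le_coe_iff]
    have h4 : 1 / (n : ℝ) * (ρ * (n * R * (1 - probBelow Q t n - Real.exp (-(n * (t - R)))))) =
        ρ * R - ρ * R * (probBelow Q t n + Real.exp (-(n * (t - R)))) := by
      field_simp
      ring
    rw [mul_sub, h4]
    linarith
  · rw [Pi.neg_apply, hd]
    simp only
    rw [divergence_of_not_ac hac, EReal.coe_mul_top_of_pos (by positivity), EReal.neg_top,
      EReal.add_bot]
    exact bot_le

lemma log_sum_exp_nonneg {α : Type*} [Fintype α] {p : α → ℝ} (hp : p ∈ stdSimplex ℝ α)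
    {g : α → ℝ} (hg : ∀ a, 0 ≤ g a) : 0 ≤ Real.log (∑ a, p a * Real.exp (g a)) := by
  refine Real.log_nonneg ?_
  calc (1 : ℝ) = ∑ a, p a := hp.2.symm
    _ ≤ _ := Finset.sum_le_sum fun a _ =>
      le_mul_of_one_le_right (hp.1 a) (Real.one_le_exp (hg a))

lemma lowerExponent_nonneg {P : MessageLaw X} (hP : IsSource P) {R ρ : ℝ} (hR : 0 ≤ R)
    (hρ : 0 ≤ ρ) : 0 ≤ lowerExponent P R ρ := by
  refine le_liminf_of_le (by isBoundedDefault) (Eventually.of_forall fun n => ?_)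
  refine le_iInf fun L => ?_
  refine EReal.coe_nonneg.2 (mul_nonneg (by positivity) (log_sum_exp_nonneg (hP n) fun x => ?_))
  exact mul_nonneg hρ (min_natCast_mul_log_two_nonneg hR n _)

theorem generalLowerBound_le_lowerExponent [Nonempty X] {P : MessageLaw X} (hP : IsSource P)
    {R ρ : ℝ} (hR : 0 ≤ R) (hρ : 0 ≤ ρ) : generalLowerBound P R ρ ≤ lowerExponent P R ρ := by
  refine max_le ?_ (iSup₂_le fun Q hQ => iSup_le fun h =>
    lowerTradeoff_le_lowerExponent hP hQ hR hρ h)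
  -- The infimum sits under a subtraction; moving terms across in `EReal` requires a finite
  -- exponent. Nonnegativity excludes `⊥`, and `⊤` is trivial.
  have h0 := lowerExponent_nonneg hP hR hρ
  have hbot : lowerExponent P R ρ ≠ ⊥ := fun h => by simp [h] at h0
  rcases eq_or_ne (lowerExponent P R ρ) ⊤ with htop | htop
  · rw [htop]; exact le_top
  refine EReal.sub_le_of_le_add ?_
  rw [add_comm, ← EReal.sub_le_iff_le_add (Or.inl hbot) (Or.inl htop)]
  refine le_iInf₂ fun Q hQ => le_iInf fun h => ?_
  have h1 := sub_upperDivergence_le_lowerExponent hP hQ hR hρ h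
  rw [EReal.sub_le_iff_le_add (Or.inl hbot) (Or.inl htop)]
  rwa [EReal.sub_le_iff_le_add (Or.inr htop) (Or.inr hbot), add_comm] at h1

end Converse

/-! ### The general upper bound -/

section Achievability

variable {X : Type*} [Fintype X]

/-- Normalizing constant of the distribution proportional to `p ^ (1 / (1 + θ))`. -/
noncomputable def tiltSum {α : Type*} [Fintype α] (p : α → ℝ) (θ : ℝ) : ℝ :=
  ∑ a, p a ^ (1 / (1 + θ))

/-- `(1 / n) (1 + θ) ln ∑ x, P x ^ (1 / (1 + θ))`. -/
noncomputable def tiltedExponent (P : MessageLaw X) (θ : ℝ) (n : ℕ) : ℝ :=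
  1 / (n : ℝ) * ((1 + θ) * Real.log (tiltSum (P n) θ))

/-- The source proportional to `P ^ (1 / (1 + θ))`. -/
noncomputable def tiltedLaw (P : MessageLaw X) (θ : ℝ) : MessageLaw X :=
  fun n x => P n x ^ (1 / (1 + θ)) / tiltSum (P n) θ

lemma exists_pos_of_mem_stdSimplex {α : Type*} [Fintype α] {p : α → ℝ}
    (hp : p ∈ stdSimplex ℝ α) : ∃ a, 0 < p a := by
  by_contra! hc
  have h0 : ∑ a, p a = 0 := Finset.sum_eq_zero fun a _ => le_antisymm (hc a) (hp.1 a)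
  exact zero_ne_one (h0.symm.trans hp.2)

lemma tiltSum_pos {α : Type*} [Fintype α] {p : α → ℝ} (hp : p ∈ stdSimplex ℝ α) (θ : ℝ) :
    0 < tiltSum p θ := by
  obtain ⟨a, ha⟩ := exists_pos_of_mem_stdSimplex hp
  exact Finset.sum_pos' (fun b _ => Real.rpow_nonneg (hp.1 b) _)
    ⟨a, Finset.mem_univ _, Real.rpow_pos_of_pos ha _⟩

lemma isSource_tiltedLaw {P : MessageLaw X} (hP : IsSource P) (θ : ℝ) :
    IsSource (tiltedLaw P θ) := fun n => by
  refine ⟨fun x => div_nonneg (Real.rpow_nonneg ((hP n).1 x) _) (tiltSum_pos (hP n) θ).le, ?_⟩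
  simp only [tiltedLaw]
  rw [← Finset.sum_div]
  exact div_self (tiltSum_pos (hP n) θ).ne'

lemma log_rpow_div {p a Z : ℝ} (hp : 0 < p) (hZ : 0 < Z) :
    Real.log (p ^ a / Z) = a * Real.log p - Real.log Z := by
  rw [Real.log_div (Real.rpow_pos_of_pos hp _).ne' hZ.ne', Real.log_rpow hp]

lemma sum_mul_log_tilted {α : Type*} [Fintype α] {p q : α → ℝ} (hp : p ∈ stdSimplex ℝ α)
    (hq : q ∈ stdSimplex ℝ α) (h : ∀ a, q a = 0 → p a = 0) (θ : ℝ) :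
    ∑ a, p a * Real.log (q a ^ (1 / (1 + θ)) / tiltSum q θ) =
      1 / (1 + θ) * ∑ a, p a * Real.log (q a) - Real.log (tiltSum q θ) := by
  have key : ∀ a, p a * Real.log (q a ^ (1 / (1 + θ)) / tiltSum q θ) =
      1 / (1 + θ) * (p a * Real.log (q a)) - p a * Real.log (tiltSum q θ) := by
    intro a
    rcases (hq.1 a).eq_or_lt with h0 | h0
    · simp [h a h0.symm]
    · rw [log_rpow_div h0 (tiltSum_pos hq θ)]; ring
  simp only [key, Finset.sum_sub_distrib, ← Finset.mul_sum, ← Finset.sum_mul, hp.2, one_mul]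

/-- On the support of the tilted law `Q` with normalizer `Z`, `ln P = (1 + θ)(ln Q + ln Z)`.
Substituting in `θ H - D = (1 + θ) H + ∑ Q ln P` leaves only `(1 + θ) ln Z`. -/
lemma tradeoff_tiltedLaw {P : MessageLaw X} (hP : IsSource P) {θ : ℝ} (hθ : 0 ≤ θ) (n : ℕ) :
    tradeoff (tiltedLaw P θ) P θ n = (tiltedExponent P θ n : EReal) := by
  have hθ1 : 1 + θ ≠ 0 := by positivity
  have hac : ∀ x, P n x = 0 → tiltedLaw P θ n x = 0 := fun x hx => by
    rw [tiltedLaw, hx, Real.zero_rpow (one_div_ne_zero hθ1), zero_div]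
  rw [tradeoff, coe_mul_sub_divergence hac, tiltedExponent, EReal.coe_eq_coe_iff]
  have h1 := sum_mul_log_tilted (isSource_tiltedLaw hP θ n) (hP n) hac θ
  have h2 : entropy (tiltedLaw P θ n) = -(1 / (1 + θ) *
      ∑ x, tiltedLaw P θ n x * Real.log (P n x) - Real.log (tiltSum (P n) θ)) := by
    rw [entropy_eq, ← h1]; rfl
  simp only [mul_sub, Finset.sum_sub_distrib]
  have h3 : ∑ x, tiltedLaw P θ n x * Real.log (tiltedLaw P θ n x) =
      -entropy (tiltedLaw P θ n) := by rw [entropy_eq, neg_neg]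
  rw [h3, h2]
  field_simp
  ring

/-- Gibbs' inequality against the tilted law, multiplied by `1 + θ`. -/
lemma tradeoff_le_tiltedExponent {P Q : MessageLaw X} (hP : IsSource P) (hQ : IsSource Q)
    {θ : ℝ} (hθ : 0 ≤ θ) {n : ℕ} (hn : 0 < n) :
    tradeoff Q P θ n ≤ (tiltedExponent P θ n : EReal) := by
  have hθ1 : 0 < 1 + θ := by positivity
  rw [tradeoff]
  by_cases hac : ∀ x, P n x = 0 → Q n x = 0
  · rw [coe_mul_sub_divergence hac, tiltedExponent, EReal.coe_le_coe_iff]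
    have h1 := sum_mul_log_tilted (hQ n) (hP n) hac θ
    have h2 := sum_mul_log_le_neg_entropy (hQ n) (isSource_tiltedLaw hP θ n).1
      (isSource_tiltedLaw hP θ n).2.le fun x hx => hac x (by
        simpa [tiltedLaw, (tiltSum_pos (hP n) θ).ne', Real.rpow_eq_zero ((hP n).1 x),
          hθ1.ne'] using hx)
    simp only [tiltedLaw] at h2
    rw [h1] at h2
    have h3 : ∑ x, Q n x * Real.log (Q n x) = -entropy (Q n) := by rw [entropy_eq, neg_neg]
    simp only [mul_sub, Finset.sum_sub_distrib, h3]
    rw [← mul_sub, ← mul_sub]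
    gcongr
    have h4 := mul_le_mul_of_nonneg_left h2 hθ1.le
    have h5 : (1 + θ) * (1 / (1 + θ) * ∑ x, Q n x * Real.log (P n x) -
        Real.log (tiltSum (P n) θ)) = ∑ x, Q n x * Real.log (P n x) -
        (1 + θ) * Real.log (tiltSum (P n) θ) := by field_simp
    rw [h5] at h4
    linarith
  · rw [coe_mul_sub_divergence_of_not hac (by positivity)]
    exact bot_le

/-- Shannon code lengths for the mixture of `q` with the uniform distribution. -/
lemma exists_kraft_le {α : Type*} [Fintype α] [Nonempty α] {q : α → ℝ}
    (hq : q ∈ stdSimplex ℝ α) : ∃ L : α → ℕ, Kraft L ∧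
      ∀ a, 0 < q a → (L a : ℝ) * Real.log 2 ≤ -Real.log (q a) + 2 * Real.log 2 := by
  have hN : (0 : ℝ) < Fintype.card α := by exact_mod_cast Fintype.card_pos
  have hl2 : 0 < Real.log 2 := Real.log_pos one_lt_two
  -- Mixing with the uniform law keeps every weight positive, so each length is finite. The mixture
  -- costs one `ln 2` and rounding up the other.
  set r : α → ℝ := fun a => (q a + (Fintype.card α : ℝ)⁻¹) / 2
  have hr : ∀ a, 0 < r a := fun a =>
    div_pos (add_pos_of_nonneg_of_pos (hq.1 a) (inv_pos.2 hN)) two_pos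
  have hr1 : ∑ a, r a = 1 := by
    simp only [r]
    rw [← Finset.sum_div, Finset.sum_add_distrib, hq.2, Finset.sum_const, Finset.card_univ,
      nsmul_eq_mul, mul_inv_cancel₀ hN.ne']
    norm_num
  have hr2 : ∀ a, 0 ≤ -Real.log (r a) / Real.log 2 := fun a =>
    div_nonneg (neg_nonneg.2 (Real.log_nonpos (hr a).le
      (hr1 ▸ Finset.single_le_sum (fun b _ => (hr b).le) (Finset.mem_univ a)))) hl2.le
  refine ⟨fun a => ⌈-Real.log (r a) / Real.log 2⌉₊, ?_, fun a ha => ?_⟩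
  · refine le_trans (Finset.sum_le_sum fun a _ => ?_) hr1.le
    rw [← exp_neg_natCast_mul_log_two, ← Real.le_log_iff_exp_le (hr a)]
    have := Nat.le_ceil (-Real.log (r a) / Real.log 2)
    rw [div_le_iff₀ hl2] at this
    linarith
  · have h1 := (Nat.ceil_lt_add_one (hr2 a)).le
    have h2 : Real.log (q a) - Real.log 2 ≤ Real.log (r a) := by
      rw [← Real.log_div ha.ne' two_ne_zero]
      refine Real.log_le_log (by positivity) ?_
      simp only [r]
      gcongr
      exact le_add_of_nonneg_right (inv_pos.2 hN).le
    calc (⌈-Real.log (r a) / Real.log 2⌉₊ : ℝ) * Real.log 2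
        ≤ (-Real.log (r a) / Real.log 2 + 1) * Real.log 2 := by gcongr
      _ = -Real.log (r a) + Real.log 2 := by field_simp
      _ ≤ _ := by linarith

/-- With Shannon lengths for the tilted law, the factor `exp(θ L ln 2)` turns `P` into a multiple of
`P ^ (1 / (1 + θ))`, as `1 - θ / (1 + θ) = 1 / (1 + θ)`. The rest of the cost is bounded by `(ρ - θ)
nR`, and `2 θ ln 2` is the mixture and rounding loss. -/
lemma compressionExponent_le [Nonempty X] {P : MessageLaw X} (hP : IsSource P) {R ρ θ : ℝ}
    (hθ : 0 ≤ θ) (hθρ : θ ≤ ρ) {n : ℕ} (hn : 0 < n) :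
    compressionExponent P R ρ n ≤
      (((ρ - θ) * R + tiltedExponent P θ n + 1 / (n : ℝ) * (2 * θ * Real.log 2) : ℝ) : EReal) := by
  have hθ1 : 0 < 1 + θ := by positivity
  have hZ := tiltSum_pos (hP n) θ
  obtain ⟨L, hL, hLe⟩ := exists_kraft_le (isSource_tiltedLaw hP θ n)
  refine iInf_le_of_le ⟨L, hL⟩ (EReal.coe_le_coe_iff.2 ?_)
  set C : ℝ := (ρ - θ) * (n * R) + θ * (2 * Real.log 2) + θ * Real.log (tiltSum (P n) θ)
  have key : ∀ x, P n x * Real.exp (ρ * min ((L x : ℝ) * Real.log 2) ((n : ℝ) * R)) ≤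
      Real.exp C * P n x ^ (1 / (1 + θ)) := by
    intro x
    rcases ((hP n).1 x).eq_or_lt with h0 | h0
    · rw [← h0, zero_mul]
      exact mul_nonneg (Real.exp_pos _).le (Real.rpow_nonneg le_rfl _)
    have h1 : ρ * min ((L x : ℝ) * Real.log 2) ((n : ℝ) * R) ≤
        θ * ((L x : ℝ) * Real.log 2) + (ρ - θ) * (n * R) := by
      have := mul_le_mul_of_nonneg_left (min_le_left ((L x : ℝ) * Real.log 2) ((n : ℝ) * R)) hθ
      have := mul_le_mul_of_nonneg_left (min_le_right ((L x : ℝ) * Real.log 2) ((n : ℝ) * R))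
        (sub_nonneg.2 hθρ)
      linarith
    have h2 := hLe x (div_pos (Real.rpow_pos_of_pos h0 _) hZ)
    rw [tiltedLaw, log_rpow_div h0 hZ] at h2
    have h3 := mul_le_mul_of_nonneg_left h2 hθ
    have h4 : Real.log (P n x) - θ * (1 / (1 + θ) * Real.log (P n x)) =
        1 / (1 + θ) * Real.log (P n x) := by field_simp; ring
    have h5 : P n x ^ (1 / (1 + θ)) = Real.exp (1 / (1 + θ) * Real.log (P n x)) := by
      rw [Real.rpow_def_of_pos h0, mul_comm]
    rw [h5, ← Real.exp_add]
    nth_rw 1 [← Real.exp_log h0]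
    rw [← Real.exp_add, Real.exp_le_exp]
    simp only [C]
    linarith
  have hpos : 0 < ∑ x, P n x * Real.exp (ρ * min ((L x : ℝ) * Real.log 2) ((n : ℝ) * R)) := by
    obtain ⟨a, ha⟩ := exists_pos_of_mem_stdSimplex (hP n)
    exact Finset.sum_pos' (fun b _ => mul_nonneg ((hP n).1 b) (Real.exp_pos _).le)
      ⟨a, Finset.mem_univ _, mul_pos ha (Real.exp_pos _)⟩
  have hsum := Real.log_le_log hpos (Finset.sum_le_sum fun x _ => key x)
  rw [← Finset.mul_sum, ← tiltSum, Real.log_mul (Real.exp_pos _).ne' hZ.ne', Real.log_exp] at hsum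
  rw [costExponent]
  have hn' : (0 : ℝ) < n := by exact_mod_cast hn
  refine (mul_le_mul_of_nonneg_left hsum (by positivity)).trans (le_of_eq ?_)
  simp only [C, tiltedExponent]
  field_simp
  ring

/-- No consistency is asked of a source, so the optimal laws at the various `n` together form an
admissible one, and the supremum passes inside the `limsup`. -/
lemma iSup_upperTradeoff {P : MessageLaw X} (hP : IsSource P) {θ : ℝ} (hθ : 0 ≤ θ) :
    ⨆ (Q : MessageLaw X) (_ : IsSource Q), upperTradeoff Q P θ =
      limsup (fun n => (tiltedExponent P θ n : EReal)) atTop := by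
  refine le_antisymm (iSup₂_le fun Q hQ => limsup_le_limsup ?_) ?_
  · filter_upwards [eventually_gt_atTop 0] with n hn
    exact tradeoff_le_tiltedExponent hP hQ hθ hn
  · refine le_iSup₂_of_le (tiltedLaw P θ) (isSource_tiltedLaw hP θ) (le_of_eq ?_)
    exact congrArg (fun u => limsup u atTop) (funext fun n => (tradeoff_tiltedLaw hP hθ n).symm)

lemma coe_add_limsup_eq (c : ℝ) (u : ℕ → ℝ) :
    (c : EReal) + limsup (fun n => (u n : EReal)) atTop =
      limsup (fun n => ((c + u n : ℝ) : EReal)) atTop := by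
  refine le_antisymm ?_ ?_
  · have h := EReal.le_limsup_add (u := fun n => (u n : EReal)) (v := fun _ => (c : EReal))
      (f := atTop)
    rw [liminf_const, add_comm] at h
    refine h.trans (le_of_eq ?_)
    refine congrArg (fun u => limsup u atTop) (funext fun n => ?_)
    rw [Pi.add_apply, EReal.coe_add, add_comm]
  · refine le_trans (le_of_eq ?_) (EReal.limsup_add_le (u := fun _ => (c : EReal))
      (v := fun n => (u n : EReal)) (f := atTop) ?_ ?_ |>.trans (le_of_eq ?_))
    · exact congrArg (fun u => limsup u atTop) (funext fun n => EReal.coe_add _ _)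
    · simp [limsup_const]
    · simp [limsup_const]
    · rw [limsup_const]

theorem upperExponent_le_generalUpperBound [Nonempty X] {P : MessageLaw X} (hP : IsSource P)
    {R ρ : ℝ} : upperExponent P R ρ ≤ generalUpperBound P R ρ := by
  refine le_iInf₂ fun θ hθ => ?_
  rw [iSup_upperTradeoff hP hθ.1, coe_add_limsup_eq]
  refine limsup_le_limsup_of_forall_pos fun ε hε => ?_
  filter_upwards [eventually_one_div_nat_mul_le (2 * θ * Real.log 2) hε,
    eventually_gt_atTop 0] with n h1 hn
  refine (compressionExponent_le hP hθ.1 hθ.2 hn).trans ?_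
  rw [← EReal.coe_add, EReal.coe_le_coe_iff]
  linarith

end Achievability

/-! ### Irreducible nonnegative matrices -/

section Perron

variable {S : Type*} [Fintype S]

lemma pow_mulVec_eq [DecidableEq S] {A : Matrix S S ℝ} {u : S → ℝ} {r : ℝ}
    (h : A.mulVec u = r • u) (k : ℕ) : (A ^ k).mulVec u = r ^ k • u := by
  induction k with
  | zero => simp
  | succ k ih => rw [pow_succ, ← Matrix.mulVec_mulVec, h, Matrix.mulVec_smul, ih, smul_smul,
      pow_succ, mul_comm]

/-- A zero spreads along every path of positive weight: read row `i₀` of `A ^ k u = r ^ k u`. This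
gives positivity of Perron vectors and stationary laws, and the maximum principle for harmonic
functions. -/
lemma eq_zero_of_mulVec_eq_smul {A : Matrix S S ℝ} (hA : A.IsIrreducible) {u : S → ℝ} {r : ℝ}
    (h : A.mulVec u = r • u) (hu : ∀ i, 0 ≤ u i) {i₀ : S} (h0 : u i₀ = 0) (j : S) : u j = 0 := by
  classical
  obtain ⟨k, _, hk⟩ := (Matrix.isIrreducible_iff_exists_pow_pos hA.nonneg).1 hA i₀ j
  have h1 := congrFun (pow_mulVec_eq h k) i₀
  rw [Pi.smul_apply, h0, smul_zero, Matrix.mulVec, dotProduct,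
    Finset.sum_eq_zero_iff_of_nonneg fun l _ =>
      mul_nonneg (Matrix.pow_apply_nonneg hA.nonneg k i₀ l) (hu l)] at h1
  exact (mul_eq_zero.1 (h1 j (Finset.mem_univ _))).resolve_left hk.ne'

lemma exists_pos_apply [Nonempty S] {A : Matrix S S ℝ} (hA : A.IsIrreducible) (i : S) :
    ∃ j, 0 < A i j := by
  classical
  by_contra! hc
  have hrow : ∀ j, A i j = 0 := fun j => le_antisymm (hc j) (hA.nonneg i j)
  obtain ⟨k, hk, hpos⟩ := (Matrix.isIrreducible_iff_exists_pow_pos hA.nonneg).1 hA i i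
  obtain ⟨m, rfl⟩ := Nat.exists_eq_succ_of_ne_zero hk.ne'
  rw [pow_succ', Matrix.mul_apply] at hpos
  simp [hrow] at hpos

/-- A periodic irreducible matrix may have no positive power, but a finite sum of powers is positive
and still commutes with `A`. -/
lemma exists_sum_pow_pos [DecidableEq S] {A : Matrix S S ℝ} (hA : A.IsIrreducible) :
    ∃ N : ℕ, ∀ i j, 0 < (∑ k ∈ Finset.range N, A ^ k) i j := by
  choose k hk hpos using (Matrix.isIrreducible_iff_exists_pow_pos hA.nonneg).1 hA
  refine ⟨(Finset.univ.sup fun ij : S × S => k ij.1 ij.2) + 1, fun i j => ?_⟩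
  rw [Matrix.sum_apply]
  refine Finset.sum_pos' (fun m _ => Matrix.pow_apply_nonneg hA.nonneg m i j)
    ⟨k i j, Finset.mem_range.2 (Nat.lt_succ_of_le ?_), hpos i j⟩
  exact Finset.le_sup (f := fun ij : S × S => k ij.1 ij.2) (Finset.mem_univ (i, j))

/-- Existence of the Perron eigenvector. -/
theorem exists_perron [Nonempty S] {A : Matrix S S ℝ} (hA : A.IsIrreducible) :
    ∃ r : ℝ, 0 < r ∧ ∃ v : S → ℝ, (∀ i, 0 < v i) ∧ A.mulVec v = r • v := by
  classical
  set M : ℝ := ∑ i, ∑ j, A i j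
  have hM : 0 ≤ M := Finset.sum_nonneg fun i _ => Finset.sum_nonneg fun j _ => hA.nonneg i j
  -- Collatz–Wielandt: maximize `r` subject to `r x ≤ A x` over the simplex; the bound `M` makes the
  -- feasible set compact.
  set C : Set (ℝ × (S → ℝ)) :=
    (Set.Icc 0 M ×ˢ stdSimplex ℝ S) ∩ {z | ∀ i, z.1 * z.2 i ≤ A.mulVec z.2 i} with hC
  have hcont : ∀ i, Continuous fun z : ℝ × (S → ℝ) => A.mulVec z.2 i := fun i => by
    simp only [Matrix.mulVec, dotProduct]; fun_prop
  have hCc : IsCompact C := by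
    refine (isCompact_Icc.prod (isCompact_stdSimplex ℝ S)).inter_right ?_
    simp only [Set.ofPred_forall]
    exact isClosed_iInter fun i => isClosed_le (by fun_prop) (hcont i)
  have hmv : ∀ x : S → ℝ, (∀ i, 0 ≤ x i) → ∀ i, 0 ≤ A.mulVec x i := fun x hx i =>
    Finset.sum_nonneg fun j _ => mul_nonneg (hA.nonneg i j) (hx j)
  have hbound : ∀ (r : ℝ) (x : S → ℝ), x ∈ stdSimplex ℝ S → (∀ i, r * x i ≤ A.mulVec x i) →
      r ≤ M := by
    intro r x hx h
    calc r = ∑ i, r * x i := by rw [← Finset.mul_sum, hx.2, mul_one]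
      _ ≤ ∑ i, A.mulVec x i := Finset.sum_le_sum fun i _ => h i
      _ ≤ M := Finset.sum_le_sum fun i _ => Finset.sum_le_sum fun j _ =>
        mul_le_of_le_one_right (hA.nonneg i j)
          (hx.2 ▸ Finset.single_le_sum (fun l _ => hx.1 l) (Finset.mem_univ j))
  have hCne : C.Nonempty := by
    obtain ⟨s⟩ := ‹Nonempty S›
    refine ⟨(0, Pi.single s 1), ⟨⟨le_rfl, hM⟩, single_mem_stdSimplex ℝ s⟩, fun i => ?_⟩
    simp only [zero_mul]
    exact hmv _ (single_mem_stdSimplex ℝ s).1 i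
  obtain ⟨⟨r, x⟩, ⟨⟨⟨hr0, hrM⟩, hx⟩, hrx⟩, hmax⟩ :=
    hCc.exists_isMaxOn hCne (f := Prod.fst) continuous_fst.continuousOn
  simp only at hr0 hrM hx hrx
  have heq : A.mulVec x = r • x := by
    by_contra hne
    -- If the slack `d = A x - r x` is nonzero, applying the positive matrix `B` makes it positive
    -- everywhere. Then `B x`, normalized, admits the larger constant `r + ε`, contradicting
    -- maximality.
    obtain ⟨N, hN⟩ := exists_sum_pow_pos hA
    set B := ∑ k ∈ Finset.range N, A ^ k
    have hAB : A * B = B * A := by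
      simp only [B, Finset.mul_sum, Finset.sum_mul, ← pow_succ, ← pow_succ']
    set d : S → ℝ := A.mulVec x - r • x
    have hd : ∀ i, 0 ≤ d i := fun i => sub_nonneg.2 (hrx i)
    obtain ⟨j, hj⟩ : ∃ j, 0 < d j := by
      by_contra! hc
      exact hne (sub_eq_zero.1 (funext fun i => le_antisymm (hc i) (hd i)))
    have hBpos : ∀ z : S → ℝ, (∀ i, 0 ≤ z i) → ∀ j, 0 < z j → ∀ i, 0 < B.mulVec z i :=
      fun z hz j hj i => Finset.sum_pos' (fun l _ => mul_nonneg (hN i l).le (hz l))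
        ⟨j, Finset.mem_univ _, mul_pos (hN i j) hj⟩
    obtain ⟨a, ha⟩ := exists_pos_of_mem_stdSimplex hx
    set y := B.mulVec x
    have hy : ∀ i, 0 < y i := hBpos x hx.1 a ha
    have hBd : ∀ i, 0 < B.mulVec d i := hBpos d hd j hj
    have hyd : A.mulVec y = r • y + B.mulVec d := by
      simp only [y, d, Matrix.mulVec_sub, Matrix.mulVec_smul, Matrix.mulVec_mulVec, hAB]
      abel
    obtain ⟨i₁, -, hi₁⟩ := Finset.exists_min_image Finset.univ
      (fun i => B.mulVec d i / y i) Finset.univ_nonempty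
    set ε := B.mulVec d i₁ / y i₁
    have hε : 0 < ε := div_pos (hBd _) (hy _)
    have hY : 0 < ∑ i, y i := Finset.sum_pos (fun i _ => hy i) Finset.univ_nonempty
    have hy' : (∑ i, y i)⁻¹ • y ∈ stdSimplex ℝ S := by
      refine ⟨fun i => (mul_pos (inv_pos.2 hY) (hy i)).le, ?_⟩
      simp only [Pi.smul_apply, smul_eq_mul]
      rw [← Finset.mul_sum, inv_mul_cancel₀ hY.ne']
    have hle : ∀ i, (r + ε) * ((∑ i, y i)⁻¹ • y) i ≤ A.mulVec ((∑ i, y i)⁻¹ • y) i := by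
      intro i
      have h1 : ε * y i ≤ B.mulVec d i := (le_div_iff₀ (hy i)).1 (hi₁ i (Finset.mem_univ _))
      rw [Matrix.mulVec_smul, hyd]
      simp only [Pi.smul_apply, smul_eq_mul, Pi.add_apply]
      rw [mul_left_comm]
      refine mul_le_mul_of_nonneg_left ?_ (inv_pos.2 hY).le
      linarith
    have hmem : (r + ε, (∑ i, y i)⁻¹ • y) ∈ C :=
      ⟨⟨⟨by positivity, hbound _ _ hy' hle⟩, hy'⟩, hle⟩
    have : r + ε ≤ r := hmax hmem
    linarith
  have hxpos : ∀ i, 0 < x i := by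
    intro i
    refine (hx.1 i).lt_of_ne fun h0 => ?_
    obtain ⟨a, ha⟩ := exists_pos_of_mem_stdSimplex hx
    exact ha.ne' (eq_zero_of_mulVec_eq_smul hA heq hx.1 h0.symm a)
  refine ⟨r, hr0.lt_of_ne fun h0 => ?_, x, hxpos, heq⟩
  obtain ⟨s⟩ := ‹Nonempty S›
  obtain ⟨t, ht⟩ := exists_pos_apply hA s
  have h1 := congrFun heq s
  rw [← h0, zero_smul, Pi.zero_apply, Matrix.mulVec, dotProduct,
    Finset.sum_eq_zero_iff_of_nonneg fun l _ => mul_nonneg (hA.nonneg s l) (hx.1 l)] at h1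
  exact (mul_pos ht (hxpos t)).ne' (h1 t (Finset.mem_univ _))

/-- Left and right Perron eigenvectors for the same eigenvalue. -/
lemma exists_perron_pair [Nonempty S] {A : Matrix S S ℝ} (hA : A.IsIrreducible) :
    ∃ r : ℝ, 0 < r ∧ ∃ u v : S → ℝ, (∀ i, 0 < u i) ∧ (∀ i, 0 < v i) ∧
      (∀ i, ∑ j, A i j * v j = r * v i) ∧ (∀ j, ∑ i, u i * A i j = r * u j) ∧
      ∑ i, u i * v i = 1 := by
  obtain ⟨r, hr, v, hv, hAv⟩ := exists_perron hA
  obtain ⟨r', hr', u, hu, hAu⟩ := exists_perron hA.transpose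
  have h1 : ∀ i, ∑ j, A i j * v j = r * v i := fun i => congrFun hAv i
  have h2 : ∀ j, ∑ i, u i * A i j = r' * u j := fun j => by
    have := congrFun hAu j
    simp only [Matrix.mulVec, dotProduct, Matrix.transpose_apply, Pi.smul_apply,
      smul_eq_mul] at this
    rw [← this]
    exact Finset.sum_congr rfl fun i _ => mul_comm _ _
  have huv : 0 < ∑ i, u i * v i :=
    Finset.sum_pos (fun i _ => mul_pos (hu i) (hv i)) Finset.univ_nonempty
  -- Evaluate `uᵀ A v` from either side; `u · v` is positive and cancels.
  have hrr : r' = r := by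
    have e1 : ∑ i, ∑ j, u i * A i j * v j = r * ∑ i, u i * v i := by
      rw [Finset.mul_sum]
      refine Finset.sum_congr rfl fun i _ => ?_
      simp only [mul_assoc]
      rw [← Finset.mul_sum, h1]; ring
    have e2 : ∑ i, ∑ j, u i * A i j * v j = r' * ∑ i, u i * v i := by
      rw [Finset.sum_comm, Finset.mul_sum]
      refine Finset.sum_congr rfl fun j _ => ?_
      rw [← Finset.sum_mul, h2]; ring
    exact mul_right_cancel₀ huv.ne' (e2.symm.trans e1)
  subst hrr
  refine ⟨r', hr, fun i => (∑ i, u i * v i)⁻¹ * u i, v, fun i => mul_pos (inv_pos.2 huv) (hu i),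
    hv, h1, fun j => ?_, ?_⟩
  · simp only [mul_assoc]
    rw [← Finset.mul_sum, h2]; ring
  · simp only [mul_assoc]
    rw [← Finset.mul_sum, inv_mul_cancel₀ huv.ne']

/-- Paths of positive weight for `A` remain so for `B`. This transfers irreducibility from `π` to
its entrywise powers and to auxiliary chains. -/
lemma isIrreducible_of_pos_imp_pos {A B : Matrix S S ℝ} (hA : A.IsIrreducible)
    (hB : ∀ i j, 0 ≤ B i j) (h : ∀ i j, 0 < A i j → 0 < B i j) : B.IsIrreducible := by
  classical
  refine (Matrix.isIrreducible_iff_exists_pow_pos hB).2 fun i j => ?_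
  obtain ⟨k, hk, hpos⟩ := (Matrix.isIrreducible_iff_exists_pow_pos hA.nonneg).1 hA i j
  refine ⟨k, hk, ?_⟩
  clear hk
  induction k generalizing j with
  | zero => simpa using hpos
  | succ k ih =>
    rw [pow_succ, Matrix.mul_apply] at hpos ⊢
    rw [Finset.sum_pos_iff_of_nonneg fun l _ =>
      mul_nonneg (Matrix.pow_apply_nonneg hA.nonneg k i l) (hA.nonneg l j)] at hpos
    obtain ⟨l, _, hl⟩ := hpos
    have h1 := (Matrix.pow_apply_nonneg hA.nonneg k i l).lt_of_ne fun h0 => by simp [← h0] at hl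
    have h2 := (hA.nonneg l j).lt_of_ne fun h0 => by simp [← h0] at hl
    exact Finset.sum_pos' (fun l _ => mul_nonneg (Matrix.pow_apply_nonneg hB k i l) (hB l j))
      ⟨l, Finset.mem_univ _, mul_pos (ih l h1) (h l j h2)⟩

lemma IsIrreducibleStationary.initial_pos {π : Matrix S S ℝ} {p : S → ℝ}
    (h : IsIrreducibleStationary π p) (s : S) : 0 < p s := by
  refine (h.initial.1 s).lt_of_ne fun h0 => ?_
  obtain ⟨a, ha⟩ := exists_pos_of_mem_stdSimplex h.initial
  refine ha.ne' (eq_zero_of_mulVec_eq_smul (r := 1) h.irreducible.transpose ?_ h.initial.1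
    h0.symm a)
  rw [Matrix.mulVec_transpose, h.stationary, one_smul]

end Perron

/-! ### The single-letter functional -/

section SingleLetter

variable {S : Type*} [Fintype S]

/-- Stationary pair distributions that are absolutely continuous with respect to `π`. -/
def acPairs (π : Matrix S S ℝ) : Set (S × S → ℝ) :=
  {Q | Q ∈ stationaryPairs S ∧ ∀ s t, π s t = 0 → Q (s, t) = 0}

/-- The real-valued form of `θ H(η | q) - D(η ‖ π | q)`. -/
noncomputable def pairTradeoff (π : Matrix S S ℝ) (θ : ℝ) (Q : S × S → ℝ) : ℝ :=
  (1 + θ) * condEntropy Q + ∑ s, ∑ t, Q (s, t) * Real.log (π s t)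

lemma marginal_nonneg {Q : S × S → ℝ} (hQ : ∀ z, 0 ≤ Q z) (s : S) : 0 ≤ marginal Q s :=
  Finset.sum_nonneg fun _ _ => hQ _

lemma eq_zero_of_marginal_eq_zero {Q : S × S → ℝ} (hQ : ∀ z, 0 ≤ Q z) {s : S}
    (h : marginal Q s = 0) (t : S) : Q (s, t) = 0 :=
  (Finset.sum_eq_zero_iff_of_nonneg fun _ _ => hQ _).1 h t (Finset.mem_univ _)

lemma marginal_mem_stdSimplex {Q : S × S → ℝ} (hQ : Q ∈ stdSimplex ℝ (S × S)) :
    marginal Q ∈ stdSimplex ℝ S := by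
  refine ⟨marginal_nonneg hQ.1, ?_⟩
  rw [← hQ.2, Fintype.sum_prod_type]
  rfl

lemma condDist_mem_stdSimplex [Nonempty S] {Q : S × S → ℝ} (hQ : ∀ z, 0 ≤ Q z) (s : S) :
    condDist Q s ∈ stdSimplex ℝ S := by
  have hc : (0 : ℝ) < Fintype.card S := by exact_mod_cast Fintype.card_pos
  by_cases h : marginal Q s = 0
  · have : condDist Q s = fun _ => 1 / (Fintype.card S : ℝ) :=
      funext fun t => by simp [condDist, h]
    rw [this]
    refine ⟨fun _ => by positivity, ?_⟩
    rw [Finset.sum_const, Finset.card_univ, nsmul_eq_mul, mul_one_div_cancel hc.ne']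
  · have : condDist Q s = fun t => Q (s, t) / marginal Q s :=
      funext fun t => by simp [condDist, h]
    rw [this]
    refine ⟨fun t => div_nonneg (hQ _) (marginal_nonneg hQ s), ?_⟩
    rw [← Finset.sum_div]
    exact div_self h

lemma marginal_mul_condDist {Q : S × S → ℝ} (hQ : ∀ z, 0 ≤ Q z) (s t : S) :
    marginal Q s * condDist Q s t = Q (s, t) := by
  by_cases h : marginal Q s = 0
  · rw [h, zero_mul, eq_zero_of_marginal_eq_zero hQ h]
  · rw [condDist, if_pos h, mul_div_cancel₀ _ h]

lemma condEntropy_eq {Q : S × S → ℝ} (hQ : ∀ z, 0 ≤ Q z) :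
    condEntropy Q = -∑ s, ∑ t, Q (s, t) * Real.log (condDist Q s t) := by
  simp only [condEntropy, entropy_eq, mul_neg, Finset.sum_neg_distrib, Finset.mul_sum]
  congr 1
  refine Finset.sum_congr rfl fun s _ => Finset.sum_congr rfl fun t _ => ?_
  rw [← marginal_mul_condDist hQ s t, mul_assoc]

/-- This form contains no division, so it shows continuity even where the marginal vanishes. -/
lemma condEntropy_eq_sub {Q : S × S → ℝ} (hQ : ∀ z, 0 ≤ Q z) :
    condEntropy Q = ∑ s, ∑ t, Real.negMulLog (Q (s, t)) - ∑ s, Real.negMulLog (marginal Q s) := by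
  rw [condEntropy_eq hQ, ← Finset.sum_neg_distrib, ← Finset.sum_sub_distrib]
  refine Finset.sum_congr rfl fun s _ => ?_
  by_cases h : marginal Q s = 0
  · simp [eq_zero_of_marginal_eq_zero hQ h, h]
  have h1 : ∀ t, Q (s, t) * Real.log (condDist Q s t) =
      -Real.negMulLog (Q (s, t)) - Q (s, t) * Real.log (marginal Q s) := by
    intro t
    rw [condDist, if_pos h]
    rcases eq_or_ne (Q (s, t)) 0 with h0 | h0
    · simp [h0]
    · rw [Real.log_div h0 h, Real.negMulLog]; ring
  simp only [h1, Finset.sum_sub_distrib, Finset.sum_neg_distrib, ← Finset.sum_mul]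
  rw [← marginal, Real.negMulLog]
  ring

lemma condEntropy_nonneg [Nonempty S] {Q : S × S → ℝ} (hQ : ∀ z, 0 ≤ Q z) :
    0 ≤ condEntropy Q :=
  Finset.sum_nonneg fun s _ => mul_nonneg (marginal_nonneg hQ s)
    (entropy_nonneg (condDist_mem_stdSimplex hQ s))

lemma condEntropy_le [Nonempty S] {Q : S × S → ℝ} (hQ : ∀ z, 0 ≤ Q z) {K : S → S → ℝ}
    (hK : ∀ s, K s ∈ stdSimplex ℝ S) (h : ∀ s t, K s t = 0 → Q (s, t) = 0) :
    condEntropy Q ≤ -∑ s, ∑ t, Q (s, t) * Real.log (K s t) := by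
  rw [condEntropy, ← Finset.sum_neg_distrib]
  refine Finset.sum_le_sum fun s _ => ?_
  by_cases h0 : marginal Q s = 0
  · simp [eq_zero_of_marginal_eq_zero hQ h0, h0]
  have h1 := sum_mul_log_le_neg_entropy (condDist_mem_stdSimplex hQ s) (hK s).1 (hK s).2.le
    (fun t ht => by rw [condDist, if_pos h0, h s t ht, zero_div])
  have h2 := mul_le_mul_of_nonneg_left h1 (marginal_nonneg hQ s)
  rw [Finset.mul_sum] at h2
  simp only [← mul_assoc, marginal_mul_condDist hQ] at h2
  linarith

lemma condDist_ac {Q : S × S → ℝ} (hQ : ∀ z, 0 ≤ Q z) {s t : S}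
    (h : condDist Q s t = 0) : Q (s, t) = 0 := by
  rw [← marginal_mul_condDist hQ, h, mul_zero]

/-- Both entropies are bounded by the cross-entropy against the conditional law of the combination,
which is linear in the pair law. Homogeneity makes `a + b = 1` unnecessary; zero coefficients are
treated apart because they break absolute continuity. -/
lemma condEntropy_concave [Nonempty S] {Q Q' : S × S → ℝ} (hQ : ∀ z, 0 ≤ Q z)
    (hQ' : ∀ z, 0 ≤ Q' z) {a b : ℝ} (ha : 0 ≤ a) (hb : 0 ≤ b) :
    a * condEntropy Q + b * condEntropy Q' ≤ condEntropy (a • Q + b • Q') := by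
  rcases ha.eq_or_lt with rfl | ha'
  · rcases hb.eq_or_lt with rfl | hb'
    · simp [condEntropy, marginal]
    · have hm : ∀ s, marginal (b • Q') s = b * marginal Q' s := fun s => by
        simp [marginal, Finset.mul_sum]
      have hc : ∀ s, condDist (b • Q') s = condDist Q' s := fun s => funext fun t => by
        simp only [condDist, hm, Pi.smul_apply, smul_eq_mul, ne_eq, mul_eq_zero, hb'.ne',
          false_or]
        split_ifs
        · rfl
        · rw [mul_div_mul_left _ _ hb'.ne']
      simp [condEntropy, hm, hc, Finset.mul_sum, mul_assoc]
  have hm : ∀ z, 0 ≤ (a • Q + b • Q') z := fun z =>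
    add_nonneg (mul_nonneg ha (hQ z)) (mul_nonneg hb (hQ' z))
  have hz : ∀ s t, condDist (a • Q + b • Q') s t = 0 → a * Q (s, t) = 0 ∧ b * Q' (s, t) = 0 := by
    intro s t h0
    have := condDist_ac hm h0
    exact (add_eq_zero_iff_of_nonneg (mul_nonneg ha (hQ _)) (mul_nonneg hb (hQ' _))).1 this
  have h1 := condEntropy_le hQ (condDist_mem_stdSimplex hm)
    (fun s t h0 => (mul_eq_zero.1 (hz s t h0).1).resolve_left ha'.ne')
  have h2 : b * condEntropy Q' ≤
      b * -∑ s, ∑ t, Q' (s, t) * Real.log (condDist (a • Q + b • Q') s t) := by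
    rcases hb.eq_or_lt with rfl | hb'
    · simp
    · exact mul_le_mul_of_nonneg_left (condEntropy_le hQ' (condDist_mem_stdSimplex hm)
        (fun s t h0 => (mul_eq_zero.1 (hz s t h0).2).resolve_left hb'.ne')) hb
  refine (add_le_add (mul_le_mul_of_nonneg_left h1 ha) h2).trans (le_of_eq ?_)
  rw [condEntropy_eq hm]
  simp only [mul_neg, Finset.mul_sum, ← Finset.sum_neg_distrib, ← Finset.sum_add_distrib]
  refine Finset.sum_congr rfl fun s _ => Finset.sum_congr rfl fun t _ => ?_
  simp only [Pi.add_apply, Pi.smul_apply, smul_eq_mul]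
  ring

lemma pairTradeoff_concave [Nonempty S] (π : Matrix S S ℝ) {θ : ℝ} (hθ : 0 ≤ θ)
    {Q Q' : S × S → ℝ} (hQ : ∀ z, 0 ≤ Q z) (hQ' : ∀ z, 0 ≤ Q' z) {a b : ℝ} (ha : 0 ≤ a)
    (hb : 0 ≤ b) :
    a * pairTradeoff π θ Q + b * pairTradeoff π θ Q' ≤ pairTradeoff π θ (a • Q + b • Q') := by
  have h := mul_le_mul_of_nonneg_left (condEntropy_concave hQ hQ' ha hb)
    (show 0 ≤ 1 + θ by positivity)
  have h1 : ∑ s, ∑ t, (a • Q + b • Q') (s, t) * Real.log (π s t) =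
      a * ∑ s, ∑ t, Q (s, t) * Real.log (π s t) + b * ∑ s, ∑ t, Q' (s, t) * Real.log (π s t) := by
    simp only [Finset.mul_sum, ← Finset.sum_add_distrib]
    refine Finset.sum_congr rfl fun s _ => Finset.sum_congr rfl fun t _ => ?_
    simp only [Pi.add_apply, Pi.smul_apply, smul_eq_mul]
    ring
  simp only [pairTradeoff, h1]
  linarith

lemma convex_acPairs (π : Matrix S S ℝ) : Convex ℝ (acPairs π) := by
  intro Q hQ Q' hQ' a b ha hb hab
  refine ⟨⟨convex_stdSimplex ℝ _ hQ.1.1 hQ'.1.1 ha hb hab, fun s => ?_⟩, fun s t h => ?_⟩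
  · simp only [Pi.add_apply, Pi.smul_apply, smul_eq_mul, Finset.sum_add_distrib,
      ← Finset.mul_sum, hQ.1.2, hQ'.1.2]
  · simp [hQ.2 s t h, hQ'.2 s t h]

lemma isCompact_acPairs (π : Matrix S S ℝ) : IsCompact (acPairs π) := by
  have : acPairs π = stdSimplex ℝ (S × S) ∩
      ({Q | ∀ s, ∑ t, Q (t, s) = ∑ t, Q (s, t)} ∩ {Q | ∀ s t, π s t = 0 → Q (s, t) = 0}) := by
    ext Q
    exact and_assoc
  rw [this]
  refine (isCompact_stdSimplex ℝ _).inter_right (IsClosed.inter ?_ ?_)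
  · simp only [Set.ofPred_forall]
    exact isClosed_iInter fun s => isClosed_eq (by fun_prop) (by fun_prop)
  · simp only [Set.ofPred_forall]
    exact isClosed_iInter fun s => isClosed_iInter fun t => isClosed_iInter fun _ =>
      isClosed_eq (by fun_prop) (by fun_prop)

lemma continuousOn_condEntropy : ContinuousOn (condEntropy (S := S)) {Q | ∀ z, 0 ≤ Q z} := by
  have : Continuous fun Q : S × S → ℝ =>
      ∑ s, ∑ t, Real.negMulLog (Q (s, t)) - ∑ s, Real.negMulLog (marginal Q s) := by
    simp only [marginal]
    have := Real.continuous_negMulLog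
    fun_prop
  exact this.continuousOn.congr fun Q hQ => condEntropy_eq_sub hQ

lemma continuousOn_pairTradeoff (π : Matrix S S ℝ) (θ : ℝ) :
    ContinuousOn (pairTradeoff π θ) {Q | ∀ z, 0 ≤ Q z} :=
  (continuousOn_condEntropy.const_mul _).add (by fun_prop)

lemma coe_sum_ereal {ι : Type*} (s : Finset ι) (f : ι → ℝ) :
    ((∑ i ∈ s, f i : ℝ) : EReal) = ∑ i ∈ s, (f i : EReal) := by
  classical
  induction s using Finset.induction_on with
  | empty => simp
  | insert i s hi ih => rw [Finset.sum_insert hi, Finset.sum_insert hi, EReal.coe_add, ih]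

lemma condDivergence_of_ac {π : Matrix S S ℝ} {Q : S × S → ℝ} (hQ : Q ∈ acPairs π) :
    condDivergence Q π =
      ((-(condEntropy Q + ∑ s, ∑ t, Q (s, t) * Real.log (π s t)) : ℝ) : EReal) := by
  have hq := hQ.1.1.1
  have key : ∀ s, (marginal Q s : EReal) * divergence (condDist Q s) (π s) =
      ((∑ t, Q (s, t) * (Real.log (condDist Q s t) - Real.log (π s t)) : ℝ) : EReal) := by
    intro s
    by_cases h : marginal Q s = 0
    · simp [h, eq_zero_of_marginal_eq_zero hq h]
    · rw [divergence_of_ac fun t ht => by rw [condDist, if_pos h, hQ.2 s t ht, zero_div],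
        ← EReal.coe_mul, Finset.mul_sum]
      simp only [← mul_assoc, marginal_mul_condDist hq]
  rw [condDivergence, condEntropy_eq hq]
  simp only [key]
  rw [← coe_sum_ereal]
  simp only [mul_sub, Finset.sum_sub_distrib]
  congr 1
  ring

lemma divergence_ne_bot {α : Type*} [Fintype α] (p q : α → ℝ) : divergence p q ≠ ⊥ := by
  rw [divergence]
  split_ifs
  · exact EReal.coe_ne_bot _
  · exact top_ne_bot

lemma sum_ereal_eq_top {ι : Type*} {s : Finset ι} {f : ι → EReal} (h : ∀ i ∈ s, f i ≠ ⊥)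
    {i : ι} (hi : i ∈ s) (hf : f i = ⊤) : ∑ i ∈ s, f i = ⊤ := by
  classical
  rw [← Finset.add_sum_erase s f hi, hf]
  refine EReal.top_add_of_ne_bot ?_
  refine Finset.sum_induction f (· ≠ ⊥) (fun a b ha hb h => ?_) (by simp) fun j hj =>
    h j (Finset.mem_of_mem_erase hj)
  rcases EReal.add_eq_bot_iff.1 h with h | h
  exacts [ha h, hb h]

lemma condDivergence_of_not_ac {π : Matrix S S ℝ} {Q : S × S → ℝ} (hQ : Q ∈ stationaryPairs S)
    (h : Q ∉ acPairs π) : condDivergence Q π = ⊤ := by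
  have hq := hQ.1.1
  obtain ⟨s, t, hst, hne⟩ : ∃ s t, π s t = 0 ∧ Q (s, t) ≠ 0 := by
    by_contra! hc
    exact h ⟨hQ, hc⟩
  have hm : marginal Q s ≠ 0 := fun h0 => hne (eq_zero_of_marginal_eq_zero hq h0 t)
  have hm' : 0 < marginal Q s := (marginal_nonneg hq s).lt_of_ne hm.symm
  refine sum_ereal_eq_top (i := s) (fun s _ h0 => ?_) (Finset.mem_univ _) ?_
  · rcases (marginal_nonneg hq s).eq_or_lt with h1 | h1
    · rw [← h1, EReal.coe_zero, zero_mul] at h0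
      exact EReal.zero_ne_bot h0
    · generalize hd : divergence (condDist Q s) (π s) = d at h0
      induction d with
      | bot => exact divergence_ne_bot _ _ hd
      | coe x => exact EReal.coe_ne_bot (marginal Q s * x) (by rw [EReal.coe_mul, h0])
      | top => rw [EReal.coe_mul_top_of_pos h1] at h0; exact top_ne_bot h0
  · rw [divergence_of_not_ac, EReal.coe_mul_top_of_pos hm']
    intro hac
    exact hne (condDist_ac hq (hac t hst))

/-- The real-valued objective `ρ min {H(η | q), R} - D(η ‖ π | q)`. -/
noncomputable def pairValue (π : Matrix S S ℝ) (R ρ : ℝ) (Q : S × S → ℝ) : ℝ :=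
  ρ * min (condEntropy Q) R + pairTradeoff π 0 Q

/-- Off `acPairs π` the objective is `⊥`, so the supremum runs over a compact convex set with a
real-valued objective. -/
lemma markovExponent_eq (π : Matrix S S ℝ) (R ρ : ℝ) :
    markovExponent π R ρ = ⨆ Q ∈ acPairs π, (pairValue π R ρ Q : EReal) := by
  have h : ∀ Q ∈ acPairs π, ((ρ * min (condEntropy Q) R : ℝ) : EReal) - condDivergence Q π =
      (pairValue π R ρ Q : EReal) := fun Q hQ => by
    rw [condDivergence_of_ac hQ, ← EReal.coe_sub, pairValue, pairTradeoff]
    congr 1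
    ring
  refine le_antisymm (iSup₂_le fun Q hQ => ?_) (iSup₂_le fun Q hQ => ?_)
  · by_cases hac : Q ∈ acPairs π
    · rw [h Q hac]
      exact le_iSup₂ (f := fun Q (_ : Q ∈ acPairs π) => (pairValue π R ρ Q : EReal)) Q hac
    · rw [condDivergence_of_not_ac hQ hac, EReal.sub_top]
      exact bot_le
  · rw [← h Q hQ]
    exact le_iSup₂ (f := fun Q (_ : Q ∈ stationaryPairs S) =>
      ((ρ * min (condEntropy Q) R : ℝ) : EReal) - condDivergence Q π) Q hQ.1

lemma pairTradeoff_eq (π : Matrix S S ℝ) (θ : ℝ) (Q : S × S → ℝ) :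
    pairTradeoff π θ Q = θ * condEntropy Q + pairTradeoff π 0 Q := by
  simp only [pairTradeoff]
  ring

/-- Sion's minimax theorem applies: the objective is affine in `θ`, and concave and continuous in
`Q`. -/
lemma exists_saddle [Nonempty S] (π : Matrix S S ℝ) (hne : (acPairs π).Nonempty) {R ρ : ℝ}
    (hρ : 0 ≤ ρ) : ∃ θ ∈ Set.Icc 0 ρ, ∃ Q ∈ acPairs π, ∀ Q' ∈ acPairs π,
      (ρ - θ) * R + pairTradeoff π θ Q' ≤ pairValue π R ρ Q := by
  have hsub : acPairs π ⊆ {Q | ∀ z, 0 ≤ Q z} := fun Q hQ => hQ.1.1.1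
  obtain ⟨θ, hθ, Q, hQ, h⟩ := Sion.exists_isSaddlePointOn (X := Set.Icc (0 : ℝ) ρ)
    (Y := acPairs π) (f := fun θ Q => (ρ - θ) * R + pairTradeoff π θ Q)
    ⟨0, le_rfl, hρ⟩ (convex_Icc _ _) isCompact_Icc
    (fun Q _ => by
      refine ContinuousOn.lowerSemicontinuousOn (Continuous.continuousOn ?_)
      simp only [pairTradeoff]
      fun_prop)
    (fun Q _ => by
      refine ConvexOn.quasiconvexOn ⟨convex_Icc _ _, fun x _ y _ a b _ _ hab => le_of_eq ?_⟩
      simp only [pairTradeoff, smul_eq_mul]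
      linear_combination (-(ρ * R) - condEntropy Q -
        ∑ s, ∑ t, Q (s, t) * Real.log (π s t)) * hab)
    (convex_acPairs π) hne (isCompact_acPairs π)
    (fun θ _ => ContinuousOn.upperSemicontinuousOn
      (continuousOn_const.add ((continuousOn_pairTradeoff π θ).mono hsub)))
    (fun θ hθ => by
      refine ConcaveOn.quasiconcaveOn ⟨convex_acPairs π, fun Q hQ Q' hQ' a b ha hb hab => ?_⟩
      have := pairTradeoff_concave π hθ.1 (hsub hQ) (hsub hQ') ha hb
      simp only [smul_eq_mul]
      linear_combination this + (ρ - θ) * R * hab)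
  refine ⟨θ, hθ, Q, hQ, fun Q' hQ' => ?_⟩
  rw [pairValue]
  -- At the saddle `Q`, any `θ'` may be used on the right. The end point `ρ` or `0`, according to
  -- the sign of `condEntropy Q - R`, gives exactly `ρ min{H, R} - D`.
  rcases le_total (condEntropy Q) R with hR | hR
  · refine (h ρ ⟨hρ, le_rfl⟩ Q' hQ').trans (le_of_eq ?_)
    simp only [min_eq_left hR, sub_self, zero_mul, zero_add]
    exact pairTradeoff_eq π ρ Q
  · refine (h 0 ⟨le_rfl, hρ⟩ Q' hQ').trans (le_of_eq ?_)
    simp only [min_eq_right hR, sub_zero]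

end SingleLetter

/-! ### Path sums -/

section Paths

variable {S : Type*} [Fintype S]

omit [Fintype S] in
lemma markovLaw_snoc (p : S → ℝ) (A : Matrix S S ℝ) (m : ℕ) (y : Fin (m + 1) → S) (t : S) :
    markovLaw p A (m + 2) (Fin.snoc (α := fun _ => S) y t) =
      markovLaw p A (m + 1) y * A (y (Fin.last m)) t := by
  rw [markovLaw, markovLaw, Fin.prod_univ_castSucc, mul_assoc]
  have h0 : (Fin.snoc (α := fun _ => S) y t : Fin (m + 2) → S) 0 = y 0 :=
    Fin.snoc_castSucc (α := fun _ => S) t y 0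
  have h1 : ∀ i : Fin m, (Fin.snoc (α := fun _ => S) y t : Fin (m + 2) → S) i.castSucc.succ =
      y i.succ := fun i => by
    rw [← Fin.castSucc_succ]
    exact Fin.snoc_castSucc (α := fun _ => S) t y i.succ
  rw [h0]
  congr 2
  · refine Finset.prod_congr rfl fun i _ => ?_
    rw [h1, Fin.snoc_castSucc]
  · rw [Fin.snoc_castSucc, Fin.succ_last, Fin.snoc_last]

lemma sum_snoc {M : Type*} [AddCommMonoid M] (n : ℕ) (F : (Fin (n + 1) → S) → M) :
    ∑ x, F x = ∑ y : Fin n → S, ∑ t, F (Fin.snoc (α := fun _ => S) y t) := by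
  rw [← (Fin.snocEquiv fun _ : Fin (n + 1) => S).sum_comp, Fintype.sum_prod_type_right]
  rfl

lemma sum_markovLaw_one (p : S → ℝ) (A : Matrix S S ℝ) (F : (Fin 1 → S) → ℝ) :
    ∑ x, markovLaw p A 1 x * F x = ∑ s, p s * F fun _ => s := by
  rw [← (Equiv.funUnique (Fin 1) S).symm.sum_comp]
  simp only [markovLaw, Finset.univ_eq_empty, Finset.prod_empty, mul_one]
  rfl

lemma sum_markovLaw_snoc (p : S → ℝ) (A : Matrix S S ℝ) (m : ℕ) (F : (Fin (m + 2) → S) → ℝ) :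
    ∑ x, markovLaw p A (m + 2) x * F x = ∑ y, markovLaw p A (m + 1) y *
      ∑ t, A (y (Fin.last m)) t * F (Fin.snoc (α := fun _ => S) y t) := by
  rw [sum_snoc]
  simp only [markovLaw_snoc, Finset.mul_sum, mul_assoc]

/-- Summing out the last state turns `A v` into `r v`, one factor `r` per transition. With `v = 1`
and `r = 1` it gives total mass one. -/
lemma sum_markovLaw_eigenvector {p : S → ℝ} {A : Matrix S S ℝ} {v : S → ℝ} {r : ℝ}
    (h : ∀ s, ∑ t, A s t * v t = r * v s) (m : ℕ) :
    ∑ x, markovLaw p A (m + 1) x * v (x (Fin.last m)) = r ^ m * ∑ s, p s * v s := by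
  induction m with
  | zero => rw [sum_markovLaw_one p A fun x => v (x (Fin.last 0)), pow_zero, one_mul]
  | succ m ih =>
    rw [sum_markovLaw_snoc p A m fun x => v (x (Fin.last (m + 1))), pow_succ', mul_assoc, ← ih,
      Finset.mul_sum]
    refine Finset.sum_congr rfl fun y _ => ?_
    simp only [Fin.snoc_last]
    rw [h]
    ring

omit [Fintype S] in
lemma markovLaw_nonneg {p : S → ℝ} {A : Matrix S S ℝ} (hp : ∀ s, 0 ≤ p s)
    (hA : ∀ s t, 0 ≤ A s t) (n : ℕ) (x : Fin n → S) : 0 ≤ markovLaw p A n x := by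
  cases n with
  | zero => exact zero_le_one
  | succ n => exact mul_nonneg (hp _) (Finset.prod_nonneg fun _ _ => hA _ _)

lemma isSource_markovLaw {p : S → ℝ} {A : Matrix S S ℝ} (hp : p ∈ stdSimplex ℝ S)
    (hA : ∀ s, A s ∈ stdSimplex ℝ S) : IsSource (markovLaw p A) := fun n => by
  refine ⟨markovLaw_nonneg hp.1 (fun s => (hA s).1) n, ?_⟩
  cases n with
  | zero => simp [markovLaw]
  | succ n =>
    have := sum_markovLaw_eigenvector (p := p) (A := A) (v := fun _ => 1) (r := 1)
      (fun s => by simp [(hA s).2]) n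
    simpa [hp.2] using this

omit [Fintype S] in
lemma markovLaw_rpow {p : S → ℝ} {A : Matrix S S ℝ} (hp : ∀ s, 0 ≤ p s)
    (hA : ∀ s t, 0 ≤ A s t) (a : ℝ) (n : ℕ) (x : Fin n → S) :
    markovLaw p A n x ^ a = markovLaw (fun s => p s ^ a) (fun s t => A s t ^ a) n x := by
  cases n with
  | zero => exact Real.one_rpow a
  | succ n =>
    simp only [markovLaw]
    rw [Real.mul_rpow (hp _) (Finset.prod_nonneg fun _ _ => hA _ _),
      Real.finsetProd_rpow _ _ fun _ _ => hA _ _]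

variable {X : Type*} [Fintype X]

lemma isSource_outputLaw {p : S → ℝ} {A : Matrix S S ℝ} (hp : p ∈ stdSimplex ℝ S)
    (hA : ∀ s, A s ∈ stdSimplex ℝ S) (f : S → X) : IsSource (outputLaw p A f) := fun n => by
  classical
  refine ⟨fun x => Finset.sum_nonneg fun s _ => (isSource_markovLaw hp hA n).1 s, ?_⟩
  rw [← (isSource_markovLaw hp hA n).2]
  simp only [outputLaw]
  convert Finset.sum_fiberwise Finset.univ (fun s : Fin n → S => f ∘ s) (markovLaw p A n)

omit [Fintype S] [Fintype X] in
lemma rpow_sum_le_sum_rpow {ι : Type*} (s : Finset ι) {f : ι → ℝ} (hf : ∀ i, 0 ≤ f i) {a : ℝ}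
    (ha : 0 < a) (ha1 : a ≤ 1) : (∑ i ∈ s, f i) ^ a ≤ ∑ i ∈ s, f i ^ a := by
  classical
  induction s using Finset.induction_on with
  | empty => simp [Real.zero_rpow ha.ne']
  | insert i s hi ih =>
    rw [Finset.sum_insert hi, Finset.sum_insert hi]
    exact (Real.rpow_add_le_add_rpow (hf i) (Finset.sum_nonneg fun j _ => hf j) ha.le
      ha1).trans (by gcongr)

/-- Merging paths into words only lowers the tilted sum, because `t ↦ t ^ a` is subadditive for `0 <
a ≤ 1`. This direction needs no unifilarity. -/
lemma tiltSum_outputLaw_le {p : S → ℝ} {A : Matrix S S ℝ} (hp : ∀ s, 0 ≤ p s)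
    (hA : ∀ s t, 0 ≤ A s t) (f : S → X) {θ : ℝ} (hθ : 0 ≤ θ) (n : ℕ) :
    tiltSum (outputLaw p A f n) θ ≤ tiltSum (markovLaw p A n) θ := by
  classical
  have h1 : (0 : ℝ) < 1 + θ := by positivity
  rw [tiltSum, tiltSum]
  calc _ ≤ ∑ x : Fin n → X, ∑ s : Fin n → S with f ∘ s = x, markovLaw p A n s ^ (1 / (1 + θ)) :=
        Finset.sum_le_sum fun x _ => by
          rw [outputLaw]
          convert rpow_sum_le_sum_rpow _ (fun s => markovLaw_nonneg hp hA n s)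
            (one_div_pos.2 h1) ((div_le_one h1).2 (by linarith))
    _ = _ := Finset.sum_fiberwise Finset.univ (fun s : Fin n → S => f ∘ s) _

/-- A power of the path law is the path weight of the entrywise power; bounding `1` by `v / min v`
at the last state reduces the sum to an eigenvector sum. -/
lemma exists_tiltSum_markovLaw_le [Nonempty S] {p : S → ℝ} {A : Matrix S S ℝ}
    (hp : ∀ s, 0 ≤ p s) (hA : ∀ s t, 0 ≤ A s t) {θ r : ℝ} {v : S → ℝ} (hv : ∀ s, 0 < v s)
    (h : ∀ s, ∑ t, A s t ^ (1 / (1 + θ)) * v t = r * v s) :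
    ∃ C, ∀ m, tiltSum (markovLaw p A (m + 1)) θ ≤ r ^ m * C := by
  obtain ⟨s₀, hs₀⟩ := Finite.exists_min v
  refine ⟨(∑ s, p s ^ (1 / (1 + θ)) * v s) / v s₀, fun m => ?_⟩
  rw [← mul_div_assoc, le_div_iff₀ (hv s₀), ← sum_markovLaw_eigenvector
    (A := fun s t => A s t ^ (1 / (1 + θ))) h m, tiltSum, Finset.sum_mul]
  refine Finset.sum_le_sum fun x _ => ?_
  rw [markovLaw_rpow hp hA]
  refine mul_le_mul_of_nonneg_left (hs₀ _) (markovLaw_nonneg (fun s => ?_) (fun s t => ?_) _ _)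
  exacts [Real.rpow_nonneg (hp s) _, Real.rpow_nonneg (hA s t) _]

/-- The Gibbs pair distribution attached to the Perron eigenvectors of `π ^ (1 / (1 + θ))`. -/
lemma exists_gibbs_pair [Nonempty S] {π : Matrix S S ℝ} (hπ : π.IsIrreducible) {θ : ℝ}
    (hθ : 0 ≤ θ) : ∃ r > 0, ∃ v : S → ℝ, (∀ s, 0 < v s) ∧
      (∀ s, ∑ t, π s t ^ (1 / (1 + θ)) * v t = r * v s) ∧
      ∃ Q ∈ acPairs π, pairTradeoff π θ Q = (1 + θ) * Real.log r := by
  have hθ1 : (0 : ℝ) < 1 + θ := by positivity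
  have hα : 1 / (1 + θ) ≠ 0 := one_div_ne_zero hθ1.ne'
  set A : Matrix S S ℝ := fun s t => π s t ^ (1 / (1 + θ)) with hA
  have hA0 : ∀ s t, 0 ≤ A s t := fun s t => Real.rpow_nonneg (hπ.nonneg s t) _
  have hAirr : A.IsIrreducible :=
    isIrreducible_of_pos_imp_pos hπ hA0 fun s t h => Real.rpow_pos_of_pos h _
  obtain ⟨r, hr, u, v, hu, hv, hAv, huA, huv⟩ := exists_perron_pair hAirr
  -- The right eigenvector makes the row sums `u s * v s`, and the left one makes the column sums
  -- the same.
  set Q : S × S → ℝ := fun z => u z.1 * A z.1 z.2 * v z.2 / r with hQdef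
  have hQ0 : ∀ z, 0 ≤ Q z := fun z =>
    div_nonneg (mul_nonneg (mul_nonneg (hu _).le (hA0 _ _)) (hv _).le) hr.le
  have hrow : ∀ s, ∑ t, Q (s, t) = u s * v s := fun s => by
    simp only [hQdef, mul_assoc]
    rw [← Finset.sum_div, ← Finset.mul_sum, hAv]
    field_simp
  have hcol : ∀ s, ∑ t, Q (t, s) = u s * v s := fun s => by
    simp only [hQdef]
    rw [← Finset.sum_div, ← Finset.sum_mul, huA]
    field_simp
  have hQsum : ∑ z, Q z = 1 := by
    rw [Fintype.sum_prod_type]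
    simp only [hrow, huv]
  have hQac : Q ∈ acPairs π := by
    refine ⟨⟨⟨hQ0, hQsum⟩, fun s => by rw [hrow, hcol]⟩, fun s t h => ?_⟩
    simp only [hQdef, hA, h, Real.zero_rpow hα, mul_zero, zero_mul, zero_div]
  refine ⟨r, hr, v, hv, hAv, Q, hQac, ?_⟩
  -- The conditional law is `π ^ (1 / (1 + θ))` times `v t / (r v s)`. The `v` terms cancel by
  -- equality of marginals, leaving `ln r`.
  have hlog : ∀ s t, Q (s, t) * Real.log (condDist Q s t) =
      1 / (1 + θ) * (Q (s, t) * Real.log (π s t)) + Q (s, t) * Real.log (v t) -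
        Q (s, t) * Real.log (v s) - Q (s, t) * Real.log r := by
    intro s t
    rcases (hπ.nonneg s t).eq_or_lt with h0 | h0
    · rw [hQac.2 s t h0.symm]; ring
    have hAst : 0 < A s t := Real.rpow_pos_of_pos h0 _
    have hm : marginal Q s = u s * v s := hrow s
    have hcd : condDist Q s t = A s t * v t / (r * v s) := by
      have := hu s; have := hv s
      rw [condDist, if_pos (by rw [hm]; positivity), hm]
      simp only [hQdef]
      field_simp
    rw [hcd, Real.log_div (mul_pos hAst (hv t)).ne' (mul_pos hr (hv s)).ne',
      Real.log_mul hAst.ne' (hv t).ne', Real.log_mul hr.ne' (hv s).ne', Real.log_rpow h0]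
    ring
  have hvt : ∑ s, ∑ t, Q (s, t) * Real.log (v t) = ∑ s, ∑ t, Q (s, t) * Real.log (v s) := by
    rw [Finset.sum_comm]
    refine Finset.sum_congr rfl fun s _ => ?_
    rw [← Finset.sum_mul, ← Finset.sum_mul, hrow, hcol]
  have hlr : ∑ s, ∑ t, Q (s, t) * Real.log r = Real.log r := by
    simp only [← Finset.sum_mul]
    rw [← Fintype.sum_prod_type, hQsum, one_mul]
  rw [pairTradeoff, condEntropy_eq hQ0]
  simp only [hlog, Finset.sum_sub_distrib, Finset.sum_add_distrib, ← Finset.mul_sum, hvt, hlr]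
  field_simp
  ring

/-- Take `θ` from the saddle point. The bound at this `θ` is the saddle objective at the Gibbs pair,
hence at most the saddle value. -/
theorem generalUpperBound_outputLaw_le {π : Matrix S S ℝ} {p : S → ℝ}
    (h : IsIrreducibleStationary π p) (f : S → X) {R ρ : ℝ} (hρ : 0 ≤ ρ) :
    generalUpperBound (outputLaw p π f) R ρ ≤ markovExponent π R ρ := by
  obtain ⟨a, _⟩ := exists_pos_of_mem_stdSimplex h.initial
  have : Nonempty S := ⟨a⟩
  have hne : (acPairs π).Nonempty := by
    obtain ⟨_, _, _, _, _, Q, hQ, _⟩ := exists_gibbs_pair h.irreducible (le_refl (0 : ℝ))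
    exact ⟨Q, hQ⟩
  obtain ⟨θ, hθ, Q₀, hQ₀, hsad⟩ := exists_saddle π hne (R := R) hρ
  obtain ⟨r, hr, v, hv, hAv, Q, hQ, hval⟩ := exists_gibbs_pair h.irreducible hθ.1
  have hsrc := isSource_outputLaw h.initial h.stochastic f
  refine le_trans (iInf₂_le θ hθ) ?_
  rw [iSup_upperTradeoff hsrc hθ.1, coe_add_limsup_eq, markovExponent_eq]
  refine le_trans ?_ (le_iSup₂ (f := fun Q (_ : Q ∈ acPairs π) => (pairValue π R ρ Q : EReal))
    Q₀ hQ₀)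
  rw [← limsup_const (f := (atTop : Filter ℕ)) (pairValue π R ρ Q₀ : EReal)]
  refine limsup_le_limsup_of_forall_pos fun ε hε => ?_
  obtain ⟨C, hC⟩ := exists_tiltSum_markovLaw_le h.initial.1 h.irreducible.nonneg hv hAv
  filter_upwards [eventually_one_div_nat_mul_le ((1 + θ) * (Real.log C - Real.log r)) hε,
    eventually_gt_atTop 0] with n h1 hn
  obtain ⟨m, rfl⟩ := Nat.exists_eq_succ_of_ne_zero hn.ne'
  have h2 := (tiltSum_outputLaw_le h.initial.1 h.irreducible.nonneg f hθ.1 (m + 1)).trans (hC m)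
  have h3 := tiltSum_pos (hsrc (m + 1)) θ
  have hCpos : 0 < C := pos_of_mul_pos_right (h3.trans_le h2) (by positivity)
  have h4 := Real.log_le_log h3 h2
  rw [Real.log_mul (by positivity) hCpos.ne', Real.log_pow] at h4
  rw [← EReal.coe_add, EReal.coe_le_coe_iff]
  have h5 : tiltedExponent (outputLaw p π f) θ (m + 1) ≤ (1 + θ) * Real.log r +
      1 / ((m + 1 : ℕ) : ℝ) * ((1 + θ) * (Real.log C - Real.log r)) := by
    rw [tiltedExponent]
    have hθ1 : 0 ≤ 1 + θ := by linarith [hθ.1]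
    calc _ ≤ 1 / ((m + 1 : ℕ) : ℝ) * ((1 + θ) * (m * Real.log r + Real.log C)) := by gcongr
      _ = _ := by push_cast; field_simp; ring
  have h6 := hsad Q hQ
  rw [hval] at h6
  linarith

end Paths

/-! ### Additive functionals of irreducible chains -/

section Ergodic

variable {S : Type*} [Fintype S]

lemma const_of_harmonic {η : Matrix S S ℝ} {q : S → ℝ} (h : IsIrreducibleStationary η q)
    {u : S → ℝ} (hu : ∀ s, ∑ t, η s t * u t = u s) (s t : S) : u s = u t := by
  have : Nonempty S := ⟨s⟩
  obtain ⟨s₀, hs₀⟩ := Finite.exists_max u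
  have key : ∀ j, u s₀ - u j = 0 := fun j =>
    eq_zero_of_mulVec_eq_smul (r := 1) (u := fun j => u s₀ - u j) h.irreducible (by
      funext i
      rw [one_smul, Matrix.mulVec, dotProduct]
      simp only [mul_sub, Finset.sum_sub_distrib, ← Finset.sum_mul, (h.stochastic i).2, hu,
        one_mul]) (fun i => sub_nonneg.2 (hs₀ i)) (i₀ := s₀) (sub_self _) j
  linarith [key s, key t]

lemma IsIrreducibleStationary.sum_mul_apply {η : Matrix S S ℝ} {q : S → ℝ}
    (h : IsIrreducibleStationary η q) (u : S → ℝ) :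
    ∑ s, q s * ∑ t, η s t * u t = ∑ t, q t * u t := by
  have h1 : ∀ t, ∑ s, q s * η s t = q t := fun t => congrFun h.stationary t
  calc ∑ s, q s * ∑ t, η s t * u t = ∑ s, ∑ t, q s * η s t * u t := by
        simp only [Finset.mul_sum, mul_assoc]
    _ = ∑ t, ∑ s, q s * η s t * u t := Finset.sum_comm
    _ = ∑ t, q t * u t := by simp only [← Finset.sum_mul, h1]

/-- Solvability of the Poisson equation. -/
lemma exists_poisson {η : Matrix S S ℝ} {q : S → ℝ} (h : IsIrreducibleStationary η q)
    (b : S → ℝ) (hb : ∑ s, q s * b s = 0) :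
    ∃ w : S → ℝ, ∀ s, w s - ∑ t, η s t * w t = b s := by
  -- `1 - η` kills constants; adding the rank-one map `w ↦ (q · w) 1` makes it injective, hence
  -- surjective. Pairing `T w = b` with `q` shows that the correction vanishes when `q · b = 0`.
  let T : (S → ℝ) →ₗ[ℝ] (S → ℝ) :=
    { toFun := fun w s => w s - ∑ t, η s t * w t + ∑ t, q t * w t
      map_add' := fun w w' => by
        funext s
        simp only [Pi.add_apply, mul_add, Finset.sum_add_distrib]
        ring
      map_smul' := fun a w => by
        funext s
        simp only [Pi.smul_apply, smul_eq_mul, RingHom.id_apply, mul_add, mul_sub,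
          Finset.mul_sum, mul_left_comm] }
  have hT : ∀ w s, T w s = w s - ∑ t, η s t * w t + ∑ t, q t * w t := fun _ _ => rfl
  have hdot : ∀ w, ∑ s, q s * T w s = ∑ t, q t * w t := fun w => by
    simp only [hT, mul_add, mul_sub, Finset.sum_add_distrib, Finset.sum_sub_distrib,
      h.sum_mul_apply, ← Finset.sum_mul, h.initial.2]
    ring
  have hinj : Function.Injective T := by
    refine (injective_iff_map_eq_zero T).2 fun w hw => ?_
    have h0 : ∑ t, q t * w t = 0 := by rw [← hdot w, hw]; simp
    have hharm : ∀ s, ∑ t, η s t * w t = w s := fun s => by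
      have := congrFun hw s
      rw [hT, h0, Pi.zero_apply] at this
      linarith
    funext s
    have : ∑ t, q t * w t = w s := by
      simp only [fun t => const_of_harmonic h hharm t s, ← Finset.sum_mul, h.initial.2, one_mul]
    rw [← this, h0, Pi.zero_apply]
  obtain ⟨w, hw⟩ := (LinearMap.injective_iff_surjective.1 hinj) b
  have h0 : ∑ t, q t * w t = 0 := by rw [← hdot w, hw, hb]
  exact ⟨w, fun s => by rw [← hw, hT, h0, add_zero]⟩

/-- Sum of `g` over the transitions of a path. -/
def pathSum (g : S → S → ℝ) {m : ℕ} (x : Fin (m + 1) → S) : ℝ :=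
  ∑ i : Fin m, g (x i.castSucc) (x i.succ)

omit [Fintype S] in
lemma pathSum_snoc (g : S → S → ℝ) {m : ℕ} (y : Fin (m + 1) → S) (t : S) :
    pathSum g (m := m + 1) (Fin.snoc (α := fun _ => S) y t) =
      pathSum g y + g (y (Fin.last m)) t := by
  have h1 : ∀ i : Fin m, (Fin.snoc (α := fun _ => S) y t : Fin (m + 2) → S) i.castSucc.succ =
      y i.succ := fun i => by
    rw [← Fin.castSucc_succ]
    exact Fin.snoc_castSucc (α := fun _ => S) t y i.succ
  rw [pathSum, Fin.sum_univ_castSucc, Fin.snoc_castSucc, Fin.succ_last, Fin.snoc_last]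
  congr 1
  refine Finset.sum_congr rfl fun i _ => ?_
  rw [h1, Fin.snoc_castSucc]

omit [Fintype S] in
lemma pathSum_telescope (g : S → S → ℝ) (w : S → ℝ) (c : ℝ) {m : ℕ} (x : Fin (m + 1) → S) :
    pathSum (fun s t => g s t + w t - w s - c) x =
      pathSum g x + w (x (Fin.last m)) - w (x 0) - m * c := by
  have h1 := Fin.sum_univ_succ fun i : Fin (m + 1) => w (x i)
  rw [Fin.sum_univ_castSucc] at h1
  simp only [pathSum, Finset.sum_sub_distrib, Finset.sum_add_distrib, Finset.sum_const,
    Finset.card_univ, Fintype.card_fin, nsmul_eq_mul]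
  linarith

lemma sum_markovLaw_mul_pathSum (p : S → ℝ) {η : Matrix S S ℝ}
    (hη : ∀ s, η s ∈ stdSimplex ℝ S) {d : S → S → ℝ} (hd : ∀ s, ∑ t, η s t * d s t = 0) (m : ℕ) :
    ∑ x, markovLaw p η (m + 1) x * pathSum d x = 0 := by
  induction m with
  | zero => simp [pathSum]
  | succ m ih =>
    rw [sum_markovLaw_snoc, ← ih]
    refine Finset.sum_congr rfl fun y _ => ?_
    simp only [pathSum_snoc, mul_add, Finset.sum_add_distrib, ← Finset.sum_mul, (hη _).2, hd]
    ring

/-- Martingale increments are orthogonal: averaging over the last state removes the cross term, so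
each transition adds at most `B`. -/
lemma sum_markovLaw_mul_pathSum_sq_le {p : S → ℝ} (hp : p ∈ stdSimplex ℝ S) {η : Matrix S S ℝ}
    (hη : ∀ s, η s ∈ stdSimplex ℝ S) {d : S → S → ℝ} (hd : ∀ s, ∑ t, η s t * d s t = 0)
    {B : ℝ} (hB : ∀ s t, d s t ^ 2 ≤ B) (m : ℕ) :
    ∑ x, markovLaw p η (m + 1) x * pathSum d x ^ 2 ≤ m * B := by
  induction m with
  | zero => simp [pathSum]
  | succ m ih =>
    rw [sum_markovLaw_snoc]
    have h1 : ∀ y : Fin (m + 1) → S, ∑ t, η (y (Fin.last m)) t *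
        pathSum d (m := m + 1) (Fin.snoc (α := fun _ => S) y t) ^ 2 ≤ pathSum d y ^ 2 + B := by
      intro y
      have e : ∀ t, η (y (Fin.last m)) t * (pathSum d y + d (y (Fin.last m)) t) ^ 2 =
          η (y (Fin.last m)) t * pathSum d y ^ 2 +
          2 * pathSum d y * (η (y (Fin.last m)) t * d (y (Fin.last m)) t) +
          η (y (Fin.last m)) t * d (y (Fin.last m)) t ^ 2 := fun t => by ring
      simp only [pathSum_snoc, e, Finset.sum_add_distrib, ← Finset.sum_mul, ← Finset.mul_sum,
        (hη _).2, hd, one_mul, mul_zero, add_zero]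
      gcongr
      calc ∑ t, η (y (Fin.last m)) t * d (y (Fin.last m)) t ^ 2
          ≤ ∑ t, η (y (Fin.last m)) t * B :=
            Finset.sum_le_sum fun t _ => mul_le_mul_of_nonneg_left (hB _ _) ((hη _).1 t)
        _ = B := by rw [← Finset.sum_mul, (hη _).2, one_mul]
    have hsrc := isSource_markovLaw hp hη (m + 1)
    calc _ ≤ ∑ y, markovLaw p η (m + 1) y * (pathSum d y ^ 2 + B) :=
          Finset.sum_le_sum fun y _ => mul_le_mul_of_nonneg_left (h1 y) (hsrc.1 y)
      _ = ∑ y, markovLaw p η (m + 1) y * pathSum d y ^ 2 + B := by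
          simp only [mul_add, Finset.sum_add_distrib, ← Finset.sum_mul, hsrc.2, one_mul]
      _ ≤ m * B + B := by gcongr
      _ = _ := by push_cast; ring

/-- An additive functional of an irreducible chain has bounded centred mean, and its centred
second moment grows at most linearly. -/
theorem exists_pathSum_moments {p : S → ℝ} (hp : p ∈ stdSimplex ℝ S) {η : Matrix S S ℝ}
    {q : S → ℝ} (h : IsIrreducibleStationary η q) (g : S → S → ℝ) {c : ℝ}
    (hc : c = ∑ s, q s * ∑ t, η s t * g s t) :
    ∃ K : ℝ, 0 ≤ K ∧ ∀ m : ℕ,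
      |∑ x, markovLaw p η (m + 1) x * (pathSum g x - ((m + 1 : ℕ) : ℝ) * c)| ≤ K ∧
      ∑ x, markovLaw p η (m + 1) x * (pathSum g x - ((m + 1 : ℕ) : ℝ) * c) ^ 2 ≤
        K * ((m + 1 : ℕ) : ℝ) := by
  -- The Poisson solution turns `g - c` plus a coboundary into a martingale increment `d`.
  obtain ⟨w, hw⟩ := exists_poisson h (fun s => ∑ t, η s t * g s t - c) (by
    simp only [mul_sub, Finset.sum_sub_distrib, ← Finset.sum_mul, h.initial.2, ← hc]
    ring)
  set d : S → S → ℝ := fun s t => g s t + w t - w s - c with hd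
  have hd0 : ∀ s, ∑ t, η s t * d s t = 0 := fun s => by
    simp only [hd, mul_sub, mul_add, Finset.sum_sub_distrib, Finset.sum_add_distrib,
      ← Finset.sum_mul, (h.stochastic s).2]
    linarith [hw s]
  set B := ∑ s, ∑ t, d s t ^ 2
  have hB : ∀ s t, d s t ^ 2 ≤ B := fun s t =>
    (Finset.single_le_sum (f := fun t => d s t ^ 2) (fun _ _ => sq_nonneg _)
      (Finset.mem_univ t)).trans (Finset.single_le_sum (f := fun s => ∑ t, d s t ^ 2)
        (fun _ _ => Finset.sum_nonneg fun _ _ => sq_nonneg _) (Finset.mem_univ s))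
  have hB0 : 0 ≤ B := Finset.sum_nonneg fun _ _ => Finset.sum_nonneg fun _ _ => sq_nonneg _
  set W := ∑ s, |w s|
  have hW : ∀ s, |w s| ≤ W := fun s =>
    Finset.single_le_sum (f := fun s => |w s|) (fun _ _ => abs_nonneg _) (Finset.mem_univ s)
  have hW0 : 0 ≤ W := Finset.sum_nonneg fun _ _ => abs_nonneg _
  -- `2 * W` covers the two end points of the telescoped coboundary; `|c|` covers having `m`
  -- transitions for `m + 1` letters.
  set E := 2 * W + |c|
  have hE : 0 ≤ E := by positivity
  have hdiff : ∀ {m : ℕ} (x : Fin (m + 1) → S),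
      |pathSum g x - ((m + 1 : ℕ) : ℝ) * c - pathSum d x| ≤ E := fun {m} x => by
    have h1 := abs_le.1 (hW (x (Fin.last m)))
    have h2 := abs_le.1 (hW (x 0))
    have h3 := neg_abs_le c
    have h4 := le_abs_self c
    rw [hd, pathSum_telescope, abs_le]
    push_cast
    constructor <;> linarith
  refine ⟨2 * B + 2 * E ^ 2 + E, by positivity, fun m => ?_⟩
  have hsrc := isSource_markovLaw hp h.stochastic (m + 1)
  constructor
  · have h0 := sum_markovLaw_mul_pathSum p h.stochastic hd0 m
    calc |∑ x, markovLaw p η (m + 1) x * (pathSum g x - ((m + 1 : ℕ) : ℝ) * c)|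
        = |∑ x, markovLaw p η (m + 1) x *
            (pathSum g x - ((m + 1 : ℕ) : ℝ) * c - pathSum d x)| := by
          simp only [mul_sub _ _ (pathSum d _), Finset.sum_sub_distrib, h0, sub_zero]
      _ ≤ ∑ x, |markovLaw p η (m + 1) x *
            (pathSum g x - ((m + 1 : ℕ) : ℝ) * c - pathSum d x)| :=
          Finset.abs_sum_le_sum_abs _ _
      _ ≤ ∑ x, markovLaw p η (m + 1) x * E := Finset.sum_le_sum fun x _ => by
          rw [abs_mul, abs_of_nonneg (hsrc.1 x)]
          exact mul_le_mul_of_nonneg_left (hdiff x) (hsrc.1 x)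
      _ = E := by rw [← Finset.sum_mul, hsrc.2, one_mul]
      _ ≤ _ := by nlinarith [sq_nonneg E]
  · have h1 : ∀ x : Fin (m + 1) → S, (pathSum g x - ((m + 1 : ℕ) : ℝ) * c) ^ 2 ≤
        2 * pathSum d x ^ 2 + 2 * E ^ 2 := fun x => by
      have h2 := sq_le_sq' (abs_le.1 (hdiff x)).1 (abs_le.1 (hdiff x)).2
      nlinarith [sq_nonneg (pathSum g x - ((m + 1 : ℕ) : ℝ) * c - pathSum d x - pathSum d x)]
    have hm : (1 : ℝ) ≤ ((m + 1 : ℕ) : ℝ) := by exact_mod_cast Nat.succ_le_succ m.zero_le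
    calc _ ≤ ∑ x, markovLaw p η (m + 1) x * (2 * pathSum d x ^ 2 + 2 * E ^ 2) :=
          Finset.sum_le_sum fun x _ => mul_le_mul_of_nonneg_left (h1 x) (hsrc.1 x)
      _ = 2 * ∑ x, markovLaw p η (m + 1) x * pathSum d x ^ 2 + 2 * E ^ 2 := by
          simp only [mul_add, Finset.sum_add_distrib, ← Finset.sum_mul, hsrc.2, one_mul,
            mul_left_comm _ (2 : ℝ), ← Finset.mul_sum]
      _ ≤ 2 * (m * B) + 2 * E ^ 2 := by
          gcongr
          exact sum_markovLaw_mul_pathSum_sq_le hp h.stochastic hd0 hB m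
      _ ≤ 2 * (((m + 1 : ℕ) : ℝ) * B) + (2 * E ^ 2 + E) * ((m + 1 : ℕ) : ℝ) := by
          have : (m : ℝ) ≤ ((m + 1 : ℕ) : ℝ) := by exact_mod_cast m.le_succ
          have h5 : 2 * E ^ 2 ≤ (2 * E ^ 2 + E) * ((m + 1 : ℕ) : ℝ) := by
            nlinarith [sq_nonneg E, mul_nonneg hE (zero_le_one.trans hm)]
          gcongr
      _ = _ := by ring

end Ergodic

/-! ### Unifilar outputs of chains with a fixed initial state -/

section Output

variable {S X : Type*} [Fintype S] [Fintype X]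

omit [Fintype S] in
lemma log_markovLaw {p : S → ℝ} {A : Matrix S S ℝ} {m : ℕ} {x : Fin (m + 1) → S}
    (h : markovLaw p A (m + 1) x ≠ 0) : Real.log (markovLaw p A (m + 1) x) =
      Real.log (p (x 0)) + pathSum (fun s t => Real.log (A s t)) x := by
  rw [markovLaw] at h ⊢
  obtain ⟨h1, h2⟩ := mul_ne_zero_iff.1 h
  rw [Real.log_mul h1 h2, Real.log_prod fun i _ => Finset.prod_ne_zero_iff.1 h2 i
    (Finset.mem_univ i)]
  rfl

omit [Fintype S] in
lemma apply_pos_of_markovLaw_pos {p : S → ℝ} {A : Matrix S S ℝ} (hA : ∀ s t, 0 ≤ A s t) {m : ℕ}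
    {x : Fin (m + 1) → S} (h : markovLaw p A (m + 1) x ≠ 0) (i : Fin m) :
    0 < A (x i.castSucc) (x i.succ) := by
  rw [markovLaw] at h
  exact (hA _ _).lt_of_ne fun h0 => h (by
    rw [Finset.prod_eq_zero (Finset.mem_univ i) h0.symm, mul_zero])

omit [Fintype S] in
lemma apply_zero_of_markovLaw_single [DecidableEq S] {s₀ : S} {A : Matrix S S ℝ} {m : ℕ}
    {x : Fin (m + 1) → S} (h : markovLaw (Pi.single s₀ 1) A (m + 1) x ≠ 0) : x 0 = s₀ := by
  rw [markovLaw] at h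
  by_contra h0
  exact h (by rw [Pi.single_eq_of_ne h0, zero_mul])

-- With a known initial state, unifilarity decodes the path letter by letter. This is why the
-- auxiliary chains start at a point mass rather than in stationarity.
omit [Fintype S] [Fintype X] in
lemma eq_of_markovLaw_single [DecidableEq S] {s₀ : S} {A π : Matrix S S ℝ}
    (hA : ∀ s t, 0 ≤ A s t) (hAπ : ∀ s t, 0 < A s t → 0 < π s t) {f : S → X}
    (hf : IsUnifilar π f) {n : ℕ} {x y : Fin n → S}
    (hx : markovLaw (Pi.single s₀ 1) A n x ≠ 0) (hy : markovLaw (Pi.single s₀ 1) A n y ≠ 0)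
    (h : f ∘ x = f ∘ y) : x = y := by
  cases n with
  | zero => exact Subsingleton.elim _ _
  | succ m =>
    funext i
    induction i using Fin.induction with
    | zero => rw [apply_zero_of_markovLaw_single hx, apply_zero_of_markovLaw_single hy]
    | succ i ih =>
      have h1 := hAπ _ _ (apply_pos_of_markovLaw_pos hA hx i)
      have h2 := hAπ _ _ (apply_pos_of_markovLaw_pos hA hy i)
      rw [← ih] at h2
      exact hf _ _ _ h1 h2 (congrFun h i.succ)

omit [Fintype X] in
lemma markovLaw_le_outputLaw {p : S → ℝ} {A : Matrix S S ℝ} (hp : ∀ s, 0 ≤ p s)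
    (hA : ∀ s t, 0 ≤ A s t) (f : S → X) {n : ℕ} (x : Fin n → S) :
    markovLaw p A n x ≤ outputLaw p A f n (f ∘ x) := by
  classical
  rw [outputLaw]
  exact Finset.single_le_sum (fun s _ => markovLaw_nonneg hp hA n s)
    (Finset.mem_filter.2 ⟨Finset.mem_univ _, rfl⟩)

omit [Fintype X] in
lemma outputLaw_comp [DecidableEq S] {s₀ : S} {A π : Matrix S S ℝ}
    (hA : ∀ s t, 0 ≤ A s t) (hAπ : ∀ s t, 0 < A s t → 0 < π s t) {f : S → X}
    (hf : IsUnifilar π f) {n : ℕ} {x : Fin n → S}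
    (hx : markovLaw (Pi.single s₀ 1) A n x ≠ 0) :
    outputLaw (Pi.single s₀ 1) A f n (f ∘ x) = markovLaw (Pi.single s₀ 1) A n x := by
  classical
  rw [outputLaw]
  refine Finset.sum_eq_single_of_mem x (Finset.mem_filter.2 ⟨Finset.mem_univ _, rfl⟩) ?_
  intro y hy hne
  by_contra h0
  exact hne (eq_of_markovLaw_single hA hAπ hf h0 hx (Finset.mem_filter.1 hy).2)

lemma sum_outputLaw_mul (p : S → ℝ) (A : Matrix S S ℝ) (f : S → X) {n : ℕ}
    (φ : (Fin n → X) → ℝ) :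
    ∑ x, outputLaw p A f n x * φ x = ∑ s, markovLaw p A n s * φ (f ∘ s) := by
  classical
  rw [← Finset.sum_fiberwise Finset.univ (fun s : Fin n → S => f ∘ s)]
  refine Finset.sum_congr rfl fun x _ => ?_
  rw [outputLaw, Finset.sum_mul]
  refine Finset.sum_congr (by congr!) fun s hs => ?_
  rw [(Finset.mem_filter.1 hs).2]

omit [Fintype X] in
lemma exists_of_outputLaw_ne_zero {p : S → ℝ} {A : Matrix S S ℝ} {f : S → X} {n : ℕ}
    {x : Fin n → X} (h : outputLaw p A f n x ≠ 0) :
    ∃ s, f ∘ s = x ∧ markovLaw p A n s ≠ 0 := by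
  classical
  rw [outputLaw] at h
  obtain ⟨s, hs, hne⟩ := Finset.exists_ne_zero_of_sum_ne_zero h
  exact ⟨s, (Finset.mem_filter.1 hs).2, hne⟩

/-- Chebyshev's inequality, with the deviation required only on the support, where the information
density is a path sum. -/
lemma sum_filter_le_second_moment {α : Type*} [Fintype α] {μ Z : α → ℝ} (hμ : ∀ a, 0 ≤ μ a)
    (P : α → Prop) [DecidablePred P] {a : ℝ} (ha : 0 < a)
    (h : ∀ x, P x → μ x ≠ 0 → a ≤ |Z x|) :
    ∑ x with P x, μ x ≤ (∑ x, μ x * Z x ^ 2) / a ^ 2 := by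
  rw [le_div_iff₀ (by positivity), Finset.sum_mul]
  calc ∑ x with P x, μ x * a ^ 2 ≤ ∑ x with P x, μ x * Z x ^ 2 := by
        refine Finset.sum_le_sum fun x hx => ?_
        rcases eq_or_ne (μ x) 0 with h0 | h0
        · simp [h0]
        · rw [← sq_abs (Z x)]
          exact mul_le_mul_of_nonneg_left
            (pow_le_pow_left₀ ha.le (h x (Finset.mem_filter.1 hx).2 h0) 2) (hμ x)
    _ ≤ _ := Finset.sum_le_sum_of_subset_of_nonneg (Finset.subset_univ _)
        fun x _ _ => mul_nonneg (hμ x) (sq_nonneg _)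

/-- The data of a chain with transition matrix `η` absolutely continuous with respect to `π`. -/
structure IsDominatedChain (η π : Matrix S S ℝ) (q : S → ℝ) (f : S → X) : Prop where
  chain : IsIrreducibleStationary η q
  dominated : ∀ s t, 0 < η s t → 0 < π s t
  unifilar : IsUnifilar π f

variable {η π : Matrix S S ℝ} {q : S → ℝ} {f : S → X}

lemma single_one_mem_stdSimplex [DecidableEq S] (s₀ : S) :
    (Pi.single s₀ 1 : S → ℝ) ∈ stdSimplex ℝ S := single_mem_stdSimplex ℝ s₀

/-- Stationary entropy rate of a chain. -/
noncomputable def chainEntropy (η : Matrix S S ℝ) (q : S → ℝ) : ℝ :=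
  ∑ s, q s * ∑ t, η s t * -Real.log (η s t)

/-- Stationary divergence rate between two chains. -/
noncomputable def chainDivergence (η π : Matrix S S ℝ) (q : S → ℝ) : ℝ :=
  ∑ s, q s * ∑ t, η s t * (Real.log (η s t) - Real.log (π s t))

omit [Fintype X] in
lemma log_inv_outputLaw [DecidableEq S] (h : IsDominatedChain η π q f) {s₀ : S} {m : ℕ}
    {x : Fin (m + 1) → S} (hx : markovLaw (Pi.single s₀ 1) η (m + 1) x ≠ 0) :
    Real.log (1 / outputLaw (Pi.single s₀ 1) η f (m + 1) (f ∘ x)) =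
      pathSum (fun s t => -Real.log (η s t)) x := by
  rw [outputLaw_comp h.chain.irreducible.nonneg h.dominated h.unifilar hx, one_div, Real.log_inv,
    log_markovLaw hx, apply_zero_of_markovLaw_single hx, Pi.single_eq_same, Real.log_one, zero_add]
  simp only [pathSum, Finset.sum_neg_distrib]

/-- The predicate `P` stands for either one-sided tail, so that one estimate serves both spectral
entropy rates. -/
lemma exists_prob_deviation_le [DecidableEq S] (h : IsDominatedChain η π q f) (s₀ : S) :
    ∃ K : ℝ, ∀ ε : ℝ, 0 < ε → ∀ (m : ℕ) (P : ℝ → Prop) [DecidablePred P],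
      (∀ z, P (1 / ((m + 1 : ℕ) : ℝ) * z) → ε * ((m + 1 : ℕ) : ℝ) ≤
        |z - ((m + 1 : ℕ) : ℝ) * chainEntropy η q|) →
      ∑ x with P (1 / ((m + 1 : ℕ) : ℝ) * Real.log (1 / outputLaw (Pi.single s₀ 1) η f (m + 1) x)),
        outputLaw (Pi.single s₀ 1) η f (m + 1) x ≤ 1 / ((m + 1 : ℕ) : ℝ) * (K / ε ^ 2) := by
  obtain ⟨K, -, hK⟩ := exists_pathSum_moments (single_one_mem_stdSimplex s₀) h.chain
    (fun s t => -Real.log (η s t)) (c := chainEntropy η q) rfl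
  refine ⟨K, fun ε hε m P _ hP => ?_⟩
  have hn : (0 : ℝ) < ((m + 1 : ℕ) : ℝ) := by positivity
  have hμ := (isSource_markovLaw (single_one_mem_stdSimplex s₀) h.chain.stochastic (m + 1)).1
  have h1 : ∑ x with P (1 / ((m + 1 : ℕ) : ℝ) *
        Real.log (1 / outputLaw (Pi.single s₀ 1) η f (m + 1) x)),
        outputLaw (Pi.single s₀ 1) η f (m + 1) x =
      ∑ x with P (1 / ((m + 1 : ℕ) : ℝ) *
        Real.log (1 / outputLaw (Pi.single s₀ 1) η f (m + 1) (f ∘ x))),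
        markovLaw (Pi.single s₀ 1) η (m + 1) x := by
    have := sum_outputLaw_mul (Pi.single s₀ 1) η f (n := m + 1) (fun x =>
      if P (1 / ((m + 1 : ℕ) : ℝ) *
        Real.log (1 / outputLaw (Pi.single s₀ 1) η f (m + 1) x)) then 1 else 0)
    simpa only [mul_ite, mul_one, mul_zero, ← Finset.sum_filter] using this
  rw [h1]
  refine (sum_filter_le_second_moment hμ _ (mul_pos hε hn) (Z := fun x =>
    pathSum (fun s t => -Real.log (η s t)) x - ((m + 1 : ℕ) : ℝ) * chainEntropy η q)
    fun x hx h0 => hP _ ?_).trans ?_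
  · rwa [log_inv_outputLaw h h0] at hx
  · refine (div_le_div_of_nonneg_right (hK m).2 (by positivity)).trans (le_of_eq ?_)
    field_simp

lemma supEntropyRate_outputLaw_le [DecidableEq S] (h : IsDominatedChain η π q f) (s₀ : S) :
    supEntropyRate (outputLaw (Pi.single s₀ 1) η f) ≤ (chainEntropy η q : EReal) := by
  have hsrc := isSource_outputLaw (single_one_mem_stdSimplex s₀) h.chain.stochastic f
  obtain ⟨K, hK⟩ := exists_prob_deviation_le h s₀
  refine le_of_forall_gt fun t ht => ?_
  obtain ⟨r, hr, hrt⟩ := EReal.lt_iff_exists_real_btwn.1 ht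
  have hr' : chainEntropy η q < r := by exact_mod_cast hr
  refine lt_of_le_of_lt (iInf₂_le r ?_) hrt
  refine squeeze_zero' (Eventually.of_forall fun n => Finset.sum_nonneg fun x _ => (hsrc n).1 x)
    ?_ (tendsto_one_div_nat_mul (K / (r - chainEntropy η q) ^ 2))
  filter_upwards [eventually_gt_atTop 0] with n hn
  obtain ⟨m, rfl⟩ := Nat.exists_eq_succ_of_ne_zero hn.ne'
  refine hK _ (sub_pos.2 hr') m (fun z => r < z) fun z hz => ?_
  rw [natCast_lt_of_one_div_mul_lt hn] at hz
  refine le_trans ?_ (le_abs_self _)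
  linarith

lemma le_infEntropyRate_outputLaw [DecidableEq S] (h : IsDominatedChain η π q f) (s₀ : S) :
    (chainEntropy η q : EReal) ≤ infEntropyRate (outputLaw (Pi.single s₀ 1) η f) := by
  have hsrc := isSource_outputLaw (single_one_mem_stdSimplex s₀) h.chain.stochastic f
  obtain ⟨K, hK⟩ := exists_prob_deviation_le h s₀
  refine le_of_forall_lt fun t ht => ?_
  obtain ⟨r, htr, hr⟩ := EReal.lt_iff_exists_real_btwn.1 ht
  have hr' : r < chainEntropy η q := by exact_mod_cast hr
  refine lt_of_lt_of_le htr (le_iSup₂_of_le r ?_ le_rfl)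
  refine squeeze_zero' (Eventually.of_forall fun n => Finset.sum_nonneg fun x _ => (hsrc n).1 x)
    ?_ (tendsto_one_div_nat_mul (K / (chainEntropy η q - r) ^ 2))
  filter_upwards [eventually_gt_atTop 0] with n hn
  obtain ⟨m, rfl⟩ := Nat.exists_eq_succ_of_ne_zero hn.ne'
  refine hK _ (sub_pos.2 hr') m (fun z => z < r) fun z hz => ?_
  rw [one_div_mul_lt_iff hn] at hz
  refine le_trans ?_ (neg_le_abs _)
  linarith

lemma exists_entropy_outputLaw_ge [DecidableEq S] (h : IsDominatedChain η π q f) (s₀ : S) :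
    ∃ K : ℝ, ∀ m : ℕ, ((m + 1 : ℕ) : ℝ) * chainEntropy η q - K ≤
      entropy (outputLaw (Pi.single s₀ 1) η f (m + 1)) := by
  obtain ⟨K, -, hK⟩ := exists_pathSum_moments (single_one_mem_stdSimplex s₀) h.chain
    (fun s t => -Real.log (η s t)) (c := chainEntropy η q) rfl
  refine ⟨K, fun m => ?_⟩
  have hsrc := isSource_markovLaw (single_one_mem_stdSimplex s₀) h.chain.stochastic (m + 1)
  have h1 : entropy (outputLaw (Pi.single s₀ 1) η f (m + 1)) =
      ∑ x, markovLaw (Pi.single s₀ 1) η (m + 1) x *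
        pathSum (fun s t => -Real.log (η s t)) x := by
    rw [entropy_eq, sum_outputLaw_mul, ← Finset.sum_neg_distrib]
    refine Finset.sum_congr rfl fun x _ => ?_
    rcases eq_or_ne (markovLaw (Pi.single s₀ 1) η (m + 1) x) 0 with h0 | h0
    · simp [h0]
    · rw [← log_inv_outputLaw h h0, one_div, Real.log_inv, mul_neg]
  have h2 := (abs_le.1 (hK m).1).1
  simp only [mul_sub, Finset.sum_sub_distrib, ← Finset.sum_mul, hsrc.2, one_mul] at h2
  rw [h1]
  linarith

omit [Fintype X] in
lemma outputLaw_ac [DecidableEq S] (h : IsDominatedChain η π q f) {p : S → ℝ}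
    (hπ : IsIrreducibleStationary π p) (s₀ : S) {n : ℕ} (x : Fin n → X)
    (hx : outputLaw p π f n x = 0) : outputLaw (Pi.single s₀ 1) η f n x = 0 := by
  by_contra hne
  obtain ⟨s, rfl, hs⟩ := exists_of_outputLaw_ne_zero hne
  have h1 := markovLaw_le_outputLaw hπ.initial.1 hπ.irreducible.nonneg f s
  rw [hx] at h1
  refine absurd h1 (not_le.2 ?_)
  cases n with
  | zero => exact zero_lt_one
  | succ m => exact mul_pos (hπ.initial_pos _) (Finset.prod_pos fun i _ =>
      h.dominated _ _ (apply_pos_of_markovLaw_pos h.chain.irreducible.nonneg hs i))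

/-- The word probability under `π` is at least that of the single decoded path. Its initial factor
costs `-ln (p s₀)`, a constant. -/
lemma exists_divergence_outputLaw_le [DecidableEq S] (h : IsDominatedChain η π q f) {p : S → ℝ}
    (hπ : IsIrreducibleStationary π p) (s₀ : S) :
    ∃ K : ℝ, ∀ m : ℕ, ∑ x, outputLaw (Pi.single s₀ 1) η f (m + 1) x *
      (Real.log (outputLaw (Pi.single s₀ 1) η f (m + 1) x) -
        Real.log (outputLaw p π f (m + 1) x)) ≤
      ((m + 1 : ℕ) : ℝ) * chainDivergence η π q + K := by
  obtain ⟨K, -, hK⟩ := exists_pathSum_moments (single_one_mem_stdSimplex s₀) h.chain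
    (fun s t => Real.log (η s t) - Real.log (π s t)) (c := chainDivergence η π q) rfl
  refine ⟨K - Real.log (p s₀), fun m => ?_⟩
  have hsrc := isSource_markovLaw (single_one_mem_stdSimplex s₀) h.chain.stochastic (m + 1)
  have h1 : ∀ x, markovLaw (Pi.single s₀ 1) η (m + 1) x *
      (Real.log (outputLaw (Pi.single s₀ 1) η f (m + 1) (f ∘ x)) -
        Real.log (outputLaw p π f (m + 1) (f ∘ x))) ≤
      markovLaw (Pi.single s₀ 1) η (m + 1) x *
        (pathSum (fun s t => Real.log (η s t) - Real.log (π s t)) x - Real.log (p s₀)) := by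
    intro x
    rcases eq_or_ne (markovLaw (Pi.single s₀ 1) η (m + 1) x) 0 with h0 | h0
    · simp [h0]
    refine mul_le_mul_of_nonneg_left ?_ (hsrc.1 x)
    have hpos : 0 < markovLaw p π (m + 1) x :=
      mul_pos (hπ.initial_pos _) (Finset.prod_pos fun i _ =>
        h.dominated _ _ (apply_pos_of_markovLaw_pos h.chain.irreducible.nonneg h0 i))
    have h2 := Real.log_le_log hpos
      (markovLaw_le_outputLaw hπ.initial.1 hπ.irreducible.nonneg f x)
    rw [log_markovLaw hpos.ne', apply_zero_of_markovLaw_single h0] at h2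
    rw [outputLaw_comp h.chain.irreducible.nonneg h.dominated h.unifilar h0, log_markovLaw h0,
      apply_zero_of_markovLaw_single h0, Pi.single_eq_same, Real.log_one, zero_add]
    have h3 : pathSum (fun s t => Real.log (η s t) - Real.log (π s t)) x =
        pathSum (fun s t => Real.log (η s t)) x - pathSum (fun s t => Real.log (π s t)) x := by
      simp only [pathSum, Finset.sum_sub_distrib]
    rw [h3]
    linarith
  rw [sum_outputLaw_mul (Pi.single s₀ 1) η f fun x =>
    Real.log (outputLaw (Pi.single s₀ 1) η f (m + 1) x) - Real.log (outputLaw p π f (m + 1) x)]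
  refine (Finset.sum_le_sum fun x _ => h1 x).trans ?_
  have h2 := (abs_le.1 (hK m).1).2
  simp only [mul_sub, Finset.sum_sub_distrib, ← Finset.sum_mul, hsrc.2, one_mul] at h2 ⊢
  linarith

lemma upperDivergence_outputLaw_le [DecidableEq S] (h : IsDominatedChain η π q f) {p : S → ℝ}
    (hπ : IsIrreducibleStationary π p) (s₀ : S) :
    upperDivergence (outputLaw (Pi.single s₀ 1) η f) (outputLaw p π f) ≤
      (chainDivergence η π q : EReal) := by
  obtain ⟨K, hK⟩ := exists_divergence_outputLaw_le h hπ s₀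
  rw [← limsup_const (f := (atTop : Filter ℕ)) (chainDivergence η π q : EReal)]
  refine limsup_le_limsup_of_forall_pos fun ε hε => ?_
  filter_upwards [eventually_one_div_nat_mul_le K hε, eventually_gt_atTop 0] with n h1 hn
  obtain ⟨m, rfl⟩ := Nat.exists_eq_succ_of_ne_zero hn.ne'
  rw [divergence_of_ac (outputLaw_ac h hπ s₀), ← EReal.coe_mul, ← EReal.coe_add,
    EReal.coe_le_coe_iff]
  calc _ ≤ 1 / ((m + 1 : ℕ) : ℝ) * (((m + 1 : ℕ) : ℝ) * chainDivergence η π q + K) := by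
        gcongr
        exact hK m
    _ = chainDivergence η π q + 1 / ((m + 1 : ℕ) : ℝ) * K := by field_simp
    _ ≤ _ := by gcongr

lemma le_lowerTradeoff_outputLaw [DecidableEq S] (h : IsDominatedChain η π q f) {p : S → ℝ}
    (hπ : IsIrreducibleStationary π p) (s₀ : S) {ρ : ℝ} (hρ : 0 ≤ ρ) :
    ((ρ * chainEntropy η q - chainDivergence η π q : ℝ) : EReal) ≤
      lowerTradeoff (outputLaw (Pi.single s₀ 1) η f) (outputLaw p π f) ρ := by
  obtain ⟨K, hK⟩ := exists_divergence_outputLaw_le h hπ s₀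
  obtain ⟨K', hK'⟩ := exists_entropy_outputLaw_ge h s₀
  rw [← liminf_const (f := (atTop : Filter ℕ))
    ((ρ * chainEntropy η q - chainDivergence η π q : ℝ) : EReal)]
  refine liminf_le_liminf_of_forall_pos fun ε hε => ?_
  filter_upwards [eventually_one_div_nat_mul_le (ρ * K' + K) hε, eventually_gt_atTop 0]
    with n h1 hn
  obtain ⟨m, rfl⟩ := Nat.exists_eq_succ_of_ne_zero hn.ne'
  rw [tradeoff, coe_mul_sub_divergence (outputLaw_ac h hπ s₀), ← EReal.coe_add,
    EReal.coe_le_coe_iff]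
  have h2 := mul_le_mul_of_nonneg_left (hK' m) hρ
  have h3 : 1 / ((m + 1 : ℕ) : ℝ) * (((m + 1 : ℕ) : ℝ) *
      (ρ * chainEntropy η q - chainDivergence η π q) - (ρ * K' + K)) ≤
      1 / ((m + 1 : ℕ) : ℝ) * (ρ * entropy (outputLaw (Pi.single s₀ 1) η f (m + 1)) -
        ∑ x, outputLaw (Pi.single s₀ 1) η f (m + 1) x *
      (Real.log (outputLaw (Pi.single s₀ 1) η f (m + 1) x) -
        Real.log (outputLaw p π f (m + 1) x))) := by
    refine mul_le_mul_of_nonneg_left ?_ (by positivity)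
    linarith [hK m]
  have h4 : 1 / ((m + 1 : ℕ) : ℝ) * (((m + 1 : ℕ) : ℝ) *
      (ρ * chainEntropy η q - chainDivergence η π q) - (ρ * K' + K)) =
      ρ * chainEntropy η q - chainDivergence η π q -
        1 / ((m + 1 : ℕ) : ℝ) * (ρ * K' + K) := by field_simp
  linarith

/-- A dominated chain gives a lower bound on the general lower bound. -/
lemma chain_le_generalLowerBound (h : IsDominatedChain η π q f) {p : S → ℝ}
    (hπ : IsIrreducibleStationary π p) {R ρ : ℝ} (hρ : 0 ≤ ρ) :
    ((ρ * min (chainEntropy η q) R - chainDivergence η π q : ℝ) : EReal) ≤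
      generalLowerBound (outputLaw p π f) R ρ := by
  classical
  obtain ⟨s₀, _⟩ := exists_pos_of_mem_stdSimplex hπ.initial
  have hsrc := isSource_outputLaw (single_one_mem_stdSimplex s₀) h.chain.stochastic f
  -- Entropy at most `R` feeds the second term of the maximum; entropy above `R` feeds the first.
  rcases le_or_gt (chainEntropy η q) R with hR | hR
  · rw [min_eq_left hR]
    refine le_max_of_le_right (le_iSup₂_of_le (outputLaw (Pi.single s₀ 1) η f) hsrc
      (le_iSup_of_le ?_ (le_lowerTradeoff_outputLaw h hπ s₀ hρ)))
    exact (supEntropyRate_outputLaw_le h s₀).trans (by exact_mod_cast hR)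
  · rw [min_eq_right hR.le, EReal.coe_sub]
    refine le_max_of_le_left (EReal.sub_le_sub le_rfl ?_)
    refine iInf₂_le_of_le (outputLaw (Pi.single s₀ 1) η f) hsrc
      (iInf_le_of_le ?_ (upperDivergence_outputLaw_le h hπ s₀))
    exact lt_of_lt_of_le (by exact_mod_cast hR) (le_infEntropyRate_outputLaw h s₀)

end Output

/-! ### The single-letter formula as a lower bound -/

section Conclusion

variable {S X : Type*} [Fintype S] [Fintype X]

lemma isIrreducibleStationary_condDist [Nonempty S] {π : Matrix S S ℝ} (hπ : π.IsIrreducible)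
    {Q : S × S → ℝ} (hQ : Q ∈ stationaryPairs S) (hpos : ∀ s t, 0 < π s t → 0 < Q (s, t)) :
    IsIrreducibleStationary (condDist Q) (marginal Q) where
  stochastic := condDist_mem_stdSimplex hQ.1.1
  irreducible := by
    refine isIrreducible_of_pos_imp_pos hπ (fun s t => (condDist_mem_stdSimplex hQ.1.1 s).1 t)
      fun s t h => ?_
    refine ((condDist_mem_stdSimplex hQ.1.1 s).1 t).lt_of_ne fun h0 => ?_
    exact (hpos s t h).ne' (condDist_ac hQ.1.1 h0.symm)
  initial := marginal_mem_stdSimplex hQ.1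
  stationary := by
    funext t
    simp only [Matrix.vecMul, dotProduct, marginal_mul_condDist hQ.1.1]
    exact hQ.2 t

lemma pairValue_le_generalLowerBound_of_pos {π : Matrix S S ℝ} {p : S → ℝ} {f : S → X}
    (hπ : IsIrreducibleStationary π p) (hf : IsUnifilar π f) {R ρ : ℝ} (hρ : 0 ≤ ρ)
    {Q : S × S → ℝ} (hQ : Q ∈ acPairs π) (hpos : ∀ s t, 0 < π s t → 0 < Q (s, t)) :
    (pairValue π R ρ Q : EReal) ≤ generalLowerBound (outputLaw p π f) R ρ := by
  obtain ⟨a, _⟩ := exists_pos_of_mem_stdSimplex hπ.initial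
  have : Nonempty S := ⟨a⟩
  have hq := hQ.1.1.1
  have hchain : IsDominatedChain (condDist Q) π (marginal Q) f := by
    refine ⟨isIrreducibleStationary_condDist hπ.irreducible hQ.1 hpos, fun s t h => ?_, hf⟩
    refine (hπ.irreducible.nonneg s t).lt_of_ne fun h0 => ?_
    have hm : 0 < marginal Q s := by
      obtain ⟨t', ht'⟩ := exists_pos_apply hπ.irreducible s
      exact Finset.sum_pos' (fun _ _ => hq _) ⟨t', Finset.mem_univ _, hpos s t' ht'⟩
    exact (mul_pos hm h).ne' (by rw [marginal_mul_condDist hq, hQ.2 s t h0.symm])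
  have h1 : chainEntropy (condDist Q) (marginal Q) = condEntropy Q := by
    simp only [chainEntropy, condEntropy_eq hq, Finset.mul_sum, ← mul_assoc,
      marginal_mul_condDist hq, mul_neg, Finset.sum_neg_distrib]
  have h2 : chainDivergence (condDist Q) π (marginal Q) = -pairTradeoff π 0 Q := by
    simp only [chainDivergence, pairTradeoff, condEntropy_eq hq, Finset.mul_sum, ← mul_assoc,
      marginal_mul_condDist hq, mul_sub, Finset.sum_sub_distrib]
    ring
  have := chain_le_generalLowerBound hchain hπ (R := R) hρ
  rwa [h1, h2, sub_neg_eq_add] at this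

/-- The pair distribution of the stationary chain itself. -/
lemma exists_stationary_pair {π : Matrix S S ℝ} {p : S → ℝ} (hπ : IsIrreducibleStationary π p) :
    ∃ Q ∈ acPairs π, (∀ s t, 0 < π s t → 0 < Q (s, t)) ∧ pairTradeoff π 0 Q = 0 := by
  have hrow : ∀ s, ∑ t, p s * π s t = p s := fun s => by
    rw [← Finset.mul_sum, (hπ.stochastic s).2, mul_one]
  have hQ0 : ∀ z : S × S, 0 ≤ p z.1 * π z.1 z.2 := fun z =>
    mul_nonneg (hπ.initial.1 _) (hπ.irreducible.nonneg _ _)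
  refine ⟨fun z => p z.1 * π z.1 z.2, ⟨⟨⟨hQ0, ?_⟩, fun s => ?_⟩, fun s t h => ?_⟩,
    fun s t h => mul_pos (hπ.initial_pos s) h, ?_⟩
  · rw [Fintype.sum_prod_type]
    simp only [hrow, hπ.initial.2]
  · simp only [hrow]
    exact congrFun hπ.stationary s
  · simp only [h, mul_zero]
  · have hm : ∀ s, marginal (fun z : S × S => p z.1 * π z.1 z.2) s = p s := hrow
    have hc : ∀ s t, condDist (fun z : S × S => p z.1 * π z.1 z.2) s t = π s t := fun s t => by
      rw [condDist, hm, if_pos (hπ.initial_pos s).ne', mul_div_cancel_left₀ _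
        (hπ.initial_pos s).ne']
    rw [pairTradeoff, condEntropy_eq hQ0]
    simp only [hc]
    ring

/-- The chain of a general `Q` may be reducible. Mixing in weight `ε` of the stationary pair law,
which charges all transitions and has zero divergence, restores irreducibility; concavity controls
the loss as `ε → 0`. -/
theorem markovExponent_le_generalLowerBound {π : Matrix S S ℝ} {p : S → ℝ} {f : S → X}
    (hπ : IsIrreducibleStationary π p) (hf : IsUnifilar π f) {R ρ : ℝ} (hρ : 0 ≤ ρ) :
    markovExponent π R ρ ≤ generalLowerBound (outputLaw p π f) R ρ := by
  obtain ⟨a, _⟩ := exists_pos_of_mem_stdSimplex hπ.initial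
  have : Nonempty S := ⟨a⟩
  obtain ⟨Q₀, hQ₀, hpos, hval⟩ := exists_stationary_pair hπ
  rw [markovExponent_eq]
  refine iSup₂_le fun Q hQ => ?_
  have hq := hQ.1.1.1
  have hq₀ := hQ₀.1.1.1
  -- The entropy of `Q₀` is replaced by its lower bound `0`, since its weight vanishes in the limit.
  have key : ∀ ε ∈ Set.Ioo (0 : ℝ) 1,
      (((1 - ε) * (ρ * condEntropy Q ⊓ ρ * R) + (1 - ε) * pairTradeoff π 0 Q +
        ε * (ρ * 0 ⊓ ρ * R) : ℝ) : EReal) ≤ generalLowerBound (outputLaw p π f) R ρ := by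
    intro ε hε
    have hε' : 0 < 1 - ε := sub_pos.2 hε.2
    have hmem := convex_acPairs π hQ hQ₀ hε'.le hε.1.le (sub_add_cancel 1 ε)
    refine le_trans (EReal.coe_le_coe_iff.2 ?_)
      (pairValue_le_generalLowerBound_of_pos hπ hf hρ hmem fun s t h =>
        add_pos_of_nonneg_of_pos (mul_nonneg hε'.le (hq _)) (mul_pos hε.1 (hpos s t h)))
    have h1 := condEntropy_concave hq hq₀ hε'.le hε.1.le
    have h2 := pairTradeoff_concave π (le_refl 0) hq hq₀ hε'.le hε.1.le
    have h3 := mul_nonneg hε.1.le (condEntropy_nonneg hq₀)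
    rw [hval, mul_zero, add_zero] at h2
    rw [pairValue, mul_min_of_nonneg _ _ hρ]
    have h4 : (1 - ε) * (ρ * condEntropy Q ⊓ ρ * R) + ε * (ρ * 0 ⊓ ρ * R) ≤
        ρ * condEntropy ((1 - ε) • Q + ε • Q₀) ⊓ ρ * R := by
      refine le_min ?_ ?_
      · have a1 := mul_le_mul_of_nonneg_left (min_le_left (ρ * condEntropy Q) (ρ * R)) hε'.le
        have a2 := mul_le_mul_of_nonneg_left (min_le_left (ρ * 0) (ρ * R)) hε.1.le
        have a3 : (1 - ε) * condEntropy Q ≤ condEntropy ((1 - ε) • Q + ε • Q₀) := by linarith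
        have a4 := mul_le_mul_of_nonneg_left a3 hρ
        linarith
      · have a1 := mul_le_mul_of_nonneg_left (min_le_right (ρ * condEntropy Q) (ρ * R)) hε'.le
        have a2 := mul_le_mul_of_nonneg_left (min_le_right (ρ * 0) (ρ * R)) hε.1.le
        linarith
    linarith
  have hlim : Tendsto (fun ε : ℝ => (((1 - ε) * (ρ * condEntropy Q ⊓ ρ * R) +
      (1 - ε) * pairTradeoff π 0 Q + ε * (ρ * 0 ⊓ ρ * R) : ℝ) : EReal)) (𝓝[>] 0)
      (𝓝 (pairValue π R ρ Q : EReal)) := by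
    refine (continuous_coe_real_ereal.tendsto _).comp ?_
    have hc : Continuous fun ε : ℝ => (1 - ε) * (ρ * condEntropy Q ⊓ ρ * R) +
      (1 - ε) * pairTradeoff π 0 Q + ε * (ρ * 0 ⊓ ρ * R) := by fun_prop
    have h0 := (hc.tendsto 0).mono_left (nhdsWithin_le_nhds (s := Set.Ioi 0))
    convert h0 using 2
    rw [pairValue, mul_min_of_nonneg _ _ hρ]
    ring
  exact le_of_tendsto hlim (by
    filter_upwards [Ioo_mem_nhdsGT (zero_lt_one' ℝ)] with ε hε using key ε hε)

theorem exponents_outputLaw {π : Matrix S S ℝ} {p : S → ℝ} {f : S → X}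
    (hπ : IsIrreducibleStationary π p) (hf : IsUnifilar π f) {R ρ : ℝ} (hR : 0 ≤ R)
    (hρ : 0 ≤ ρ) :
    upperExponent (outputLaw p π f) R ρ = markovExponent π R ρ ∧
      lowerExponent (outputLaw p π f) R ρ = markovExponent π R ρ ∧
      generalLowerBound (outputLaw p π f) R ρ = markovExponent π R ρ ∧
      generalUpperBound (outputLaw p π f) R ρ = markovExponent π R ρ := by
  obtain ⟨a, _⟩ := exists_pos_of_mem_stdSimplex hπ.initial
  have : Nonempty X := ⟨f a⟩
  have hsrc := isSource_outputLaw hπ.initial hπ.stochastic f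
  have h1 := markovExponent_le_generalLowerBound hπ hf (R := R) hρ
  have h2 := generalLowerBound_le_lowerExponent hsrc hR hρ
  have h3 : lowerExponent (outputLaw p π f) R ρ ≤ upperExponent (outputLaw p π f) R ρ :=
    liminf_le_limsup
  have h4 := upperExponent_le_generalUpperBound hsrc (R := R) (ρ := ρ)
  have h5 := generalUpperBound_outputLaw_le hπ f (R := R) hρ
  exact ⟨le_antisymm (h4.trans h5) (h1.trans (h2.trans h3)),
    le_antisymm (h3.trans (h4.trans h5)) (h1.trans h2),
    le_antisymm (h2.trans (h3.trans (h4.trans h5))) h1,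
    le_antisymm h5 (h1.trans (h2.trans (h3.trans h4)))⟩

omit [Fintype X] in
lemma outputLaw_id (p : S → ℝ) (π : Matrix S S ℝ) : outputLaw p π id = markovLaw p π := by
  classical
  funext n x
  rw [outputLaw]
  simp only [Function.id_comp]
  rw [Finset.sum_filter, Finset.sum_ite_eq' Finset.univ x, if_pos (Finset.mem_univ x)]

end Conclusion

end ShannonCipher

theorem mainTheorem9 {X S : Type*} [Fintype X] [Fintype S] (R ρ : ℝ) (hR : 0 < R) (hρ : 0 < ρ) :
    (∀ (π : Matrix X X ℝ) (p : X → ℝ), ShannonCipher.IsIrreducibleStationary π p →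
      ShannonCipher.upperExponent (ShannonCipher.markovLaw p π) R ρ =
          ShannonCipher.markovExponent π R ρ ∧
        ShannonCipher.lowerExponent (ShannonCipher.markovLaw p π) R ρ =
          ShannonCipher.markovExponent π R ρ ∧
        ShannonCipher.generalLowerBound (ShannonCipher.markovLaw p π) R ρ =
          ShannonCipher.markovExponent π R ρ ∧
        ShannonCipher.generalUpperBound (ShannonCipher.markovLaw p π) R ρ =
          ShannonCipher.markovExponent π R ρ) ∧
    (∀ (π : Matrix S S ℝ) (p : S → ℝ) (f : S → X), ShannonCipher.IsIrreducibleStationary π p →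
      ShannonCipher.IsUnifilar π f →
      ShannonCipher.upperExponent (ShannonCipher.outputLaw p π f) R ρ =
          ShannonCipher.markovExponent π R ρ ∧
        ShannonCipher.lowerExponent (ShannonCipher.outputLaw p π f) R ρ =
          ShannonCipher.markovExponent π R ρ ∧
        ShannonCipher.generalLowerBound (ShannonCipher.outputLaw p π f) R ρ =
          ShannonCipher.markovExponent π R ρ ∧
        ShannonCipher.generalUpperBound (ShannonCipher.outputLaw p π f) R ρ =
          ShannonCipher.markovExponent π R ρ) := by
  refine ⟨fun π p h => ?_, fun π p f h hf => ShannonCipher.exponents_outputLaw h hf hR.le hρ.le⟩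
  have := ShannonCipher.exponents_outputLaw (f := (id : X → X)) h (fun _ _ _ _ _ e => e)
    (R := R) hR.le hρ.le
  rwa [ShannonCipher.outputLaw_id] at this
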